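/- Let $n,m,\ell$ be integers with $1\le \ell\le m\le n$ and let $\mu=2^m1^{n-m}$ be the partition of $n+m$ whose Young diagram has a first column of length $n$ and a second column of length $m$. A tableau of shape $\mu$ is a bijective filling of the cells of $\mu$ with the letters $1,\dots,n+m$; the symmetric group $\mathfrak S_{n+m}$ acts on tableaux by replacing each entry by its image. Let $M^\mu$ be the complex vector space spanned by the tableaux $t$ of shape $\mu$, modulo the relations $t+s=0$ whenever $s$ is obtained from $t$ by switching two entries of the same column, and let $[t]\in M^\mu$ be the class of $t$; the action on tableaux makes $M^\mu$ an $\mathfrak S_{n+m}$-module. For a tableau $t$ of shape $\mu$ with row stabilizer $R_t$ and column stabilizer $C_t$, put $$e_t=\sum_{\alpha\in R_t}\alpha\ \sum_{\beta\in C_t}\operatorname{sgn}(\beta)\,\beta\in\mathbb C\mathfrak S_{n+m},$$ and let the Specht module $S^\mu$ be the subspace of the left regular representation $\mathbb C\mathfrak S_{n+m}$ spanned by $\{\tau e_t:\tau\in\mathfrak S_{n+m}\}$, where $t$ is any fixed tableau of shape $\mu$. Let $\eta_\ell:M^\mu\to M^\mu$ be the (well-defined, $\mathfrak S_{n+m}$-equivariant)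 linear map $$\eta_\ell[t]=\binom m\ell[t]-\sum_s[s],$$ where $s$ ranges over all tableaux obtained from $t$ by exchanging $\ell$ entries of the second column with $\ell$ entries of the first column, preserving the vertical order of each set of $\ell$ entries. Let $H^{\mu,\ell}\subseteq M^\mu$ be the subspace generated by all $\eta_\ell([t])$, i.e. the image of $\eta_\ell$. Then $M^\mu/H^{\mu,\ell}\cong S^\mu$ as $\mathfrak S_{n+m}$-modules if and only if $$\omega_{\ell,i}:=\binom m\ell-\sum_{k=0}^{\ell}\binom{m-i}{k}\binom{n-i}{k}\binom{i}{\ell-k}(-1)^k\neq 0\qquad\text{for every } i=0,1,\dots,m-1.$$ -/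

import Mathlib

noncomputable section

namespace TwoColumnSpecht

open Equiv

/-! ### Tableaux, column tabloids and Specht modules for a general Young diagram -/

/-- The cells `(row, column)` of a Young diagram. -/
abbrev Cell (μ : YoungDiagram) : Type := {c : ℕ × ℕ // c ∈ μ.cells}

/-- The row of a cell. -/
abbrev Cell.row {μ : YoungDiagram} (c : Cell μ) : ℕ := c.1.1

/-- The column of a cell. -/
abbrev Cell.col {μ : YoungDiagram} (c : Cell μ) : ℕ := c.1.2

/-- Young tableaux: bijective fillings of the cells of `μ` with the `N` letters `Fin N`.
(This type is inhabited exactly when `μ` has `N` cells.) -/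
abbrev Tableau (μ : YoungDiagram) (N : ℕ) : Type := Cell μ ≃ Fin N

/-- The column relations: `t + s`, where `s` is obtained from the tableau `t` by switching the
entries of two different cells of the same column. -/
def columnRelations (μ : YoungDiagram) (N : ℕ) : Submodule ℂ (Tableau μ N →₀ ℂ) :=
  Submodule.span ℂ {x | ∃ (t : Tableau μ N) (a b : Cell μ), a ≠ b ∧ a.col = b.col ∧
    x = Finsupp.single t 1 + Finsupp.single ((swap a b).trans t) 1}

/-- The space `M^μ` of column tabloids. -/
abbrev TabloidSpace (μ : YoungDiagram) (N : ℕ) : Type :=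
  (Tableau μ N →₀ ℂ) ⧸ columnRelations μ N

/-- The column tabloid `[t]`. -/
def tabloid {μ : YoungDiagram} {N : ℕ} (t : Tableau μ N) : TabloidSpace μ N :=
  (columnRelations μ N).mkQ (Finsupp.single t 1)

/-- The symmetric group acts on tableaux by replacing every entry by its image. -/
def tableauRep (μ : YoungDiagram) (N : ℕ) :
    Representation ℂ (Perm (Fin N)) (Tableau μ N →₀ ℂ) where
  toFun σ := Finsupp.lmapDomain ℂ ℂ fun t : Tableau μ N => t.trans σ
  map_one' := by
    refine Finsupp.lhom_ext' fun t => LinearMap.ext_ring ?_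
    simp [Finsupp.mapDomain_single]
    rfl
  map_mul' σ τ := by
    refine Finsupp.lhom_ext' fun t => LinearMap.ext_ring ?_
    simp [Finsupp.mapDomain_single]
    rfl

lemma tableauRep_single {μ : YoungDiagram} {N : ℕ} (σ : Perm (Fin N)) (t : Tableau μ N) (c : ℂ) :
    tableauRep μ N σ (Finsupp.single t c) = Finsupp.single (t.trans σ) c := by
  simp [tableauRep, Finsupp.mapDomain_single]

lemma columnRelations_invariant (μ : YoungDiagram) (N : ℕ) (σ : Perm (Fin N)) :
    columnRelations μ N ≤ (columnRelations μ N).comap (tableauRep μ N σ) := by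
  refine Submodule.span_le.2 ?_
  rintro _ ⟨t, a, b, hab, hc, rfl⟩
  refine Submodule.subset_span ⟨t.trans σ, a, b, hab, hc, ?_⟩
  rw [map_add, tableauRep_single, tableauRep_single]
  rfl

/-- The representation of the symmetric group on `M^μ`. -/
def tabloidRep (μ : YoungDiagram) (N : ℕ) :
    Representation ℂ (Perm (Fin N)) (TabloidSpace μ N) :=
  (tableauRep μ N).quotient (columnRelations μ N) (columnRelations_invariant μ N)

lemma tabloidRep_tabloid {μ : YoungDiagram} {N : ℕ} (σ : Perm (Fin N)) (t : Tableau μ N) :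
    tabloidRep μ N σ (tabloid t) = tabloid (t.trans σ) := by
  change (columnRelations μ N).mkQ (tableauRep μ N σ (Finsupp.single t 1)) = _
  rw [tableauRep_single]
  rfl

lemma tabloidSpace_hom_ext {μ : YoungDiagram} {N : ℕ} {V : Type*} [AddCommGroup V] [Module ℂ V]
    {f g : TabloidSpace μ N →ₗ[ℂ] V} (h : ∀ t, f (tabloid t) = g (tabloid t)) : f = g := by
  refine Submodule.linearMap_qext _ (Finsupp.lhom_ext' fun t => LinearMap.ext_ring ?_)
  exact h t

/-- The row stabilizer `R_t`: permutations of the letters preserving every row of `t`. -/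
def rowStabilizer {μ : YoungDiagram} {N : ℕ} (t : Tableau μ N) : Finset (Perm (Fin N)) :=
  Finset.univ.filter fun σ => ∀ x, (t.symm (σ x)).row = (t.symm x).row

/-- The column stabilizer `C_t`: permutations of the letters preserving every column of `t`. -/
def colStabilizer {μ : YoungDiagram} {N : ℕ} (t : Tableau μ N) : Finset (Perm (Fin N)) :=
  Finset.univ.filter fun σ => ∀ x, (t.symm (σ x)).col = (t.symm x).col

/-- The Young symmetrizer `e_t`, an element of the group algebra. -/
def youngSymmetrizer {μ : YoungDiagram} {N : ℕ} (t : Tableau μ N) :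
    MonoidAlgebra ℂ (Perm (Fin N)) :=
  (∑ α ∈ rowStabilizer t, MonoidAlgebra.of ℂ (Perm (Fin N)) α) *
    ∑ β ∈ colStabilizer t, ((Perm.sign β : ℤ) : ℂ) • MonoidAlgebra.of ℂ (Perm (Fin N)) β

/-- The Specht module as a subspace of the group algebra: the span of all `τ e_t`. -/
def spechtSubmodule {μ : YoungDiagram} {N : ℕ} (t : Tableau μ N) :
    Submodule ℂ (MonoidAlgebra ℂ (Perm (Fin N))) :=
  Submodule.span ℂ (Set.range fun τ : Perm (Fin N) =>
    MonoidAlgebra.of ℂ (Perm (Fin N)) τ * youngSymmetrizer t)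

lemma leftRegular_apply {G : Type*} [Group G] (σ : G) (x : MonoidAlgebra ℂ G) :
    Representation.leftRegular ℂ G σ x = MonoidAlgebra.of ℂ G σ * x := by
  rw [← Representation.asAlgebraHom_ofMulAction_smul_eq_mul, Representation.asAlgebraHom_of]

lemma spechtSubmodule_invariant {μ : YoungDiagram} {N : ℕ} (t : Tableau μ N)
    (σ : Perm (Fin N)) :
    spechtSubmodule t ≤
      (spechtSubmodule t).comap (Representation.leftRegular ℂ (Perm (Fin N)) σ) := by
  refine Submodule.span_le.2 ?_
  rintro _ ⟨τ, rfl⟩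
  refine Submodule.subset_span ⟨σ * τ, ?_⟩
  simp only [leftRegular_apply, map_mul, mul_assoc]

/-- The Specht module `S^μ`, as a subrepresentation of the left regular representation. -/
def spechtRep {μ : YoungDiagram} {N : ℕ} (t : Tableau μ N) :
    Representation ℂ (Perm (Fin N)) (spechtSubmodule t) :=
  (Representation.leftRegular ℂ (Perm (Fin N))).subrepresentation (spechtSubmodule t)
    (spechtSubmodule_invariant t)

/-! ### Column-preserving permutations of the cells act on tabloids by their sign -/

lemma tabloid_swap {μ : YoungDiagram} {N : ℕ} (t : Tableau μ N) {a b : Cell μ} (hab : a ≠ b)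
    (hc : a.col = b.col) : tabloid ((swap a b).trans t) = -tabloid t := by
  have h : (columnRelations μ N).mkQ
      (Finsupp.single t 1 + Finsupp.single ((swap a b).trans t) 1) = 0 := by
    rw [Submodule.mkQ_apply, Submodule.Quotient.mk_eq_zero]
    exact Submodule.subset_span ⟨t, a, b, hab, hc, rfl⟩
  rw [map_add, add_comm] at h
  exact eq_neg_of_add_eq_zero_left h

lemma tabloid_perm {μ : YoungDiagram} {N : ℕ} (σ : Perm (Cell μ))
    (hσ : ∀ c, (σ c).col = c.col) (t : Tableau μ N) :
    tabloid (σ.trans t) = ((Perm.sign σ : ℤ) : ℂ) • tabloid t := by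
  induction h : σ.support.card using Nat.strong_induction_on generalizing σ t with
  | _ k ih =>
    by_cases h1 : σ = 1
    · subst h1
      simp
      rfl
    · obtain ⟨x, hx⟩ : ∃ x, σ x ≠ x := by
        by_contra! hcon
        exact h1 (Equiv.ext hcon)
      have hlt : (swap x (σ x) * σ).support.card < k := by
        rw [← h]
        exact Perm.card_support_swap_mul hx
      have hcol : ∀ c, ((swap x (σ x) * σ) c).col = c.col := by
        intro c
        rw [Perm.mul_apply]
        rw [swap_apply_def]
        split_ifs with h2 h3
        · rw [hσ x, ← hσ c, h2]
        · rw [← hσ x, ← h3, hσ c]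
        · exact hσ c
      have hrec := ih _ hlt _ hcol ((swap x (σ x)).trans t) rfl
      have he : (swap x (σ x) * σ).trans ((swap x (σ x)).trans t) = σ.trans t := by
        ext c
        simp
      rw [he, tabloid_swap t hx.symm (hσ x).symm, Perm.sign_mul, Perm.sign_swap hx.symm] at hrec
      rw [hrec]
      simp

/-! ### The two-column shape `2^m 1^{n-m}` -/

/-- The Young diagram of `2^m 1^{n-m}`: a first column with `n` cells and a second column with
`m ≤ n` cells. -/
def twoColumn (n m : ℕ) (hmn : m ≤ n) : YoungDiagram where
  cells := (Finset.range n ×ˢ {0}) ∪ (Finset.range m ×ˢ {1})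
  isLowerSet := by
    rintro ⟨i, j⟩ ⟨i', j'⟩ ⟨hi, hj⟩ h
    simp only [Finset.coe_union, Set.mem_union, Finset.mem_coe, Finset.mem_product,
      Finset.mem_range, Finset.mem_singleton] at h hi hj ⊢
    omega

lemma mem_twoColumn {n m : ℕ} {hmn : m ≤ n} {c : ℕ × ℕ} :
    c ∈ (twoColumn n m hmn).cells ↔ (c.1 < n ∧ c.2 = 0) ∨ (c.1 < m ∧ c.2 = 1) := by
  simp only [twoColumn, Finset.mem_union, Finset.mem_product, Finset.mem_range,
    Finset.mem_singleton]

/-- The cells of `2^m 1^{n-m}` by column: `inl i` is the cell in row `i` of the first column,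
`inr j` is the cell in row `j` of the second column. -/
def cellEquiv (n m : ℕ) (hmn : m ≤ n) : Fin n ⊕ Fin m ≃ Cell (twoColumn n m hmn) where
  toFun := Sum.elim (fun i => ⟨(i, 0), mem_twoColumn.2 (by simp)⟩) fun j => ⟨(j, 1), mem_twoColumn.2 (by simp)⟩
  invFun c := if h : c.col = 0
    then Sum.inl ⟨c.row, by
      have := mem_twoColumn.1 c.2
      simp only [Cell.col, Cell.row] at h ⊢
      omega⟩
    else Sum.inr ⟨c.row, by
      have := mem_twoColumn.1 c.2
      simp only [Cell.col, Cell.row] at h ⊢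
      omega⟩
  left_inv x := by rcases x with i | j <;> simp
  right_inv c := by
    obtain ⟨⟨i, j⟩, hc⟩ := c
    rcases mem_twoColumn.1 hc with h | h
    · obtain ⟨-, rfl⟩ := h
      simp
    · obtain ⟨-, rfl⟩ := h
      simp

/-- The order preserving bijection between two `ℓ`-element sets of rows. -/
def orderMatch {n m ℓ : ℕ} (A : {A : Finset (Fin n) // A.card = ℓ})
    (B : {B : Finset (Fin m) // B.card = ℓ}) : A.1 ≃o B.1 :=
  (A.1.orderIsoOfFin A.2).symm.trans (B.1.orderIsoOfFin B.2)

/-- The exchange of the positions in the rows `A` of the first column with the positions in the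
rows `B` of the second column, preserving the vertical order; all other positions are fixed. -/
def exchangeFun {n m ℓ : ℕ} (A : {A : Finset (Fin n) // A.card = ℓ})
    (B : {B : Finset (Fin m) // B.card = ℓ}) : Fin n ⊕ Fin m → Fin n ⊕ Fin m
  | Sum.inl i => if h : i ∈ A.1 then Sum.inr (orderMatch A B ⟨i, h⟩).1 else Sum.inl i
  | Sum.inr j => if h : j ∈ B.1 then Sum.inl ((orderMatch A B).symm ⟨j, h⟩).1 else Sum.inr j

lemma exchangeFun_involutive {n m ℓ : ℕ} (A : {A : Finset (Fin n) // A.card = ℓ})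
    (B : {B : Finset (Fin m) // B.card = ℓ}) : Function.Involutive (exchangeFun A B) := by
  rintro (i | j)
  · by_cases h : i ∈ A.1 <;> simp [exchangeFun, h]
  · by_cases h : j ∈ B.1 <;> simp [exchangeFun, h]

/-- The exchange as a permutation of positions. -/
def exchangePerm {n m ℓ : ℕ} (A : {A : Finset (Fin n) // A.card = ℓ})
    (B : {B : Finset (Fin m) // B.card = ℓ}) : Perm (Fin n ⊕ Fin m) :=
  (exchangeFun_involutive A B).toPerm

/-- The exchange as a permutation of the cells of `2^m 1^{n-m}`. -/
def exchange {n m ℓ : ℕ} (hmn : m ≤ n) (A : {A : Finset (Fin n) // A.card = ℓ})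
    (B : {B : Finset (Fin m) // B.card = ℓ}) : Perm (Cell (twoColumn n m hmn)) :=
  (cellEquiv n m hmn).permCongr (exchangePerm A B)

lemma sign_exchangePerm {n m ℓ : ℕ} (A A' : {A : Finset (Fin n) // A.card = ℓ})
    (B B' : {B : Finset (Fin m) // B.card = ℓ}) :
    Perm.sign (exchangePerm A B) = Perm.sign (exchangePerm A' B') := by
  set α := orderMatch A A' with hα
  set β := orderMatch B B' with hβ
  let a : Perm (Fin n) := α.toEquiv.extendSubtype
  let b : Perm (Fin m) := β.toEquiv.extendSubtype
  let G : Perm (Fin n ⊕ Fin m) := sumCongr a b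
  have ha : ∀ i (h : i ∈ A.1), a i = (α ⟨i, h⟩).1 := fun i h =>
    α.toEquiv.extendSubtype_apply_of_mem i h
  have hb : ∀ i (h : i ∈ B.1), b i = (β ⟨i, h⟩).1 := fun i h =>
    β.toEquiv.extendSubtype_apply_of_mem i h
  have ha' : ∀ i, i ∉ A.1 → a i ∉ A'.1 := fun i h => α.toEquiv.extendSubtype_not_mem i h
  have hb' : ∀ i, i ∉ B.1 → b i ∉ B'.1 := fun i h => β.toEquiv.extendSubtype_not_mem i h
  have key : exchangePerm A' B' * G = G * exchangePerm A B := by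
    ext1 x
    simp only [Perm.mul_apply]
    change exchangeFun A' B' (G x) = G (exchangeFun A B x)
    rcases x with i | j
    · by_cases h : i ∈ A.1
      · have h' : a i ∈ A'.1 := by rw [ha i h]; exact (α ⟨i, h⟩).2
        have e1 : G (Sum.inl i) = Sum.inl (a i) := rfl
        have e2 : (⟨a i, h'⟩ : A'.1) = α ⟨i, h⟩ := Subtype.ext (ha i h)
        have e3 : ∀ k, G (Sum.inr k) = Sum.inr (b k) := fun _ => rfl
        simp only [e1, exchangeFun, h, h', dif_pos, e2, e3, hb _ (Subtype.coe_prop _)]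
        refine congrArg _ (congrArg Subtype.val ?_)
        simp only [hα, hβ, orderMatch, OrderIso.trans_apply, OrderIso.symm_trans,
          OrderIso.symm_symm, OrderIso.symm_apply_apply, Subtype.coe_eta]
      · have e1 : G (Sum.inl i) = Sum.inl (a i) := rfl
        simp [e1, exchangeFun, h, ha' i h]
    · by_cases h : j ∈ B.1
      · have h' : b j ∈ B'.1 := by rw [hb j h]; exact (β ⟨j, h⟩).2
        have e1 : G (Sum.inr j) = Sum.inr (b j) := rfl
        have e2 : (⟨b j, h'⟩ : B'.1) = β ⟨j, h⟩ := Subtype.ext (hb j h)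
        have e3 : ∀ k, G (Sum.inl k) = Sum.inl (a k) := fun _ => rfl
        simp only [e1, exchangeFun, h, h', dif_pos, e2, e3, ha _ (Subtype.coe_prop _)]
        refine congrArg _ (congrArg Subtype.val ?_)
        simp only [hα, hβ, orderMatch, OrderIso.trans_apply, OrderIso.symm_trans,
          OrderIso.symm_symm, OrderIso.symm_apply_apply, Subtype.coe_eta]
      · have e1 : G (Sum.inr j) = Sum.inr (b j) := rfl
        simp [e1, exchangeFun, h, hb' j h]
  have hs := congrArg Perm.sign key
  rw [Perm.sign_mul, Perm.sign_mul, mul_comm] at hs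
  exact (mul_left_cancel hs).symm

/-- Permutations of the rows act on `ℓ`-element sets of rows. -/
def mapSubsets {n ℓ : ℕ} (p : Perm (Fin n)) :
    {A : Finset (Fin n) // A.card = ℓ} ≃ {A : Finset (Fin n) // A.card = ℓ} :=
  p.finsetCongr.subtypeEquiv fun A => by simp

lemma isLeft_exchange_conj {n m ℓ : ℕ} (A : {A : Finset (Fin n) // A.card = ℓ})
    (B : {B : Finset (Fin m) // B.card = ℓ}) (p : Perm (Fin n)) (q : Perm (Fin m))
    (x : Fin n ⊕ Fin m) :
    (exchangeFun (mapSubsets p A) (mapSubsets q B)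
      (sumCongr p q (exchangeFun A B x))).isLeft = x.isLeft := by
  have hA : ∀ i, p i ∈ (mapSubsets p A).1 ↔ i ∈ A.1 := by simp [mapSubsets]
  have hB : ∀ i, q i ∈ (mapSubsets q B).1 ↔ i ∈ B.1 := by simp [mapSubsets]
  rcases x with i | j
  · by_cases h : i ∈ A.1 <;> simp [exchangeFun, h, hA, hB]
  · by_cases h : j ∈ B.1 <;> simp [exchangeFun, h, hA, hB]

lemma col_cellEquiv {n m : ℕ} (hmn : m ≤ n) (x y : Fin n ⊕ Fin m) (h : x.isLeft = y.isLeft) :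
    (cellEquiv n m hmn x).col = (cellEquiv n m hmn y).col := by
  rcases x with i | i <;> rcases y with j | j <;> simp_all [cellEquiv]

/-- The sum of all tabloids obtained from the tableau `t` by exchanging `ℓ` entries of the second
column with `ℓ` entries of the first column, preserving the vertical order of both sets. -/
def exchangeSum {n m : ℕ} (hmn : m ≤ n) (ℓ : ℕ) {N : ℕ} (t : Tableau (twoColumn n m hmn) N) :
    TabloidSpace (twoColumn n m hmn) N :=
  ∑ A : {A : Finset (Fin n) // A.card = ℓ}, ∑ B : {B : Finset (Fin m) // B.card = ℓ},
    tabloid ((exchange hmn A B).trans t)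

lemma exchangeSum_perm {n m : ℕ} (hmn : m ≤ n) (ℓ : ℕ) {N : ℕ}
    (t : Tableau (twoColumn n m hmn) N) (p : Perm (Fin n)) (q : Perm (Fin m)) :
    exchangeSum hmn ℓ (((cellEquiv n m hmn).permCongr (sumCongr p q)).trans t) =
      ((Perm.sign (sumCongr p q) : ℤ) : ℂ) • exchangeSum hmn ℓ t := by
  unfold exchangeSum
  rw [Finset.smul_sum]
  refine Fintype.sum_equiv (mapSubsets p) _ _ fun A => ?_
  rw [Finset.smul_sum]
  refine Fintype.sum_equiv (mapSubsets q) _ _ fun B => ?_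
  let w' := exchangePerm (mapSubsets p A) (mapSubsets q B)
  let c : Perm (Fin n ⊕ Fin m) := w' * sumCongr p q * exchangePerm A B
  have hc : Perm.sign c = Perm.sign (sumCongr p q) := by
    simp only [c, w', Perm.sign_mul, sign_exchangePerm (mapSubsets p A) A (mapSubsets q B) B]
    rw [mul_comm, ← mul_assoc, Int.units_mul_self, one_mul]
  have h1 : (exchange hmn A B).trans
      (((cellEquiv n m hmn).permCongr (sumCongr p q)).trans t) =
      ((cellEquiv n m hmn).permCongr c).trans
        ((exchange hmn (mapSubsets p A) (mapSubsets q B)).trans t) := by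
    ext1 x
    have hw : ∀ y, w' (w' y) = y := fun y => exchangeFun_involutive _ _ y
    simp only [exchange, c, permCongr_apply, trans_apply, symm_apply_apply, Perm.mul_apply]
    change _ = t (cellEquiv n m hmn (w' (w' _)))
    rw [hw]
  rw [h1, tabloid_perm, Perm.sign_permCongr, hc]
  intro x
  obtain ⟨y, rfl⟩ := (cellEquiv n m hmn).surjective x
  simp only [permCongr_apply, symm_apply_apply]
  exact col_cellEquiv hmn _ _ (isLeft_exchange_conj A B p q y)

lemma exchangeSum_swap {n m : ℕ} (hmn : m ≤ n) (ℓ : ℕ) {N : ℕ}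
    (t : Tableau (twoColumn n m hmn) N) {a b : Cell (twoColumn n m hmn)} (hab : a ≠ b)
    (hc : a.col = b.col) : exchangeSum hmn ℓ ((swap a b).trans t) = -exchangeSum hmn ℓ t := by
  obtain ⟨p, q, hpq⟩ : ∃ (p : Perm (Fin n)) (q : Perm (Fin m)),
      (cellEquiv n m hmn).permCongr (sumCongr p q) = swap a b := by
    obtain ⟨x, rfl⟩ := (cellEquiv n m hmn).surjective a
    obtain ⟨y, rfl⟩ := (cellEquiv n m hmn).surjective b
    have hs : swap (cellEquiv n m hmn x) (cellEquiv n m hmn y) =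
        (cellEquiv n m hmn).permCongr (swap x y) := by
      rw [← symm_trans_swap_trans]; rfl
    rcases x with i | i <;> rcases y with j | j
    · exact ⟨swap i j, 1, by rw [hs, ← Perm.sumCongr_swap_one]⟩
    · simp [cellEquiv] at hc
    · simp [cellEquiv] at hc
    · exact ⟨1, swap i j, by rw [hs, ← Perm.sumCongr_one_swap]⟩
  have hsign : Perm.sign (sumCongr p q) = -1 := by
    rw [← Perm.sign_permCongr (cellEquiv n m hmn), hpq, Perm.sign_swap hab]
  rw [← hpq, exchangeSum_perm, hsign]
  simp

/-- The operator `[t] ↦ (m choose ℓ) [t] - ∑ [s]`, first on the free vector space on tableaux. -/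
def etaFree {n m : ℕ} (hmn : m ≤ n) (ℓ N : ℕ) :
    (Tableau (twoColumn n m hmn) N →₀ ℂ) →ₗ[ℂ] TabloidSpace (twoColumn n m hmn) N :=
  Finsupp.linearCombination ℂ fun t => (m.choose ℓ : ℂ) • tabloid t - exchangeSum hmn ℓ t

lemma columnRelations_le_ker_etaFree {n m : ℕ} (hmn : m ≤ n) (ℓ N : ℕ) :
    columnRelations (twoColumn n m hmn) N ≤ LinearMap.ker (etaFree hmn ℓ N) := by
  refine Submodule.span_le.2 ?_
  rintro _ ⟨t, a, b, hab, hc, rfl⟩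
  simp [etaFree, tabloid_swap t hab hc, exchangeSum_swap hmn ℓ t hab hc]

/-- The operator `η_ℓ` on `M^μ` for `μ = 2^m 1^{n-m}`. -/
def eta {n m : ℕ} (hmn : m ≤ n) (ℓ N : ℕ) :
    TabloidSpace (twoColumn n m hmn) N →ₗ[ℂ] TabloidSpace (twoColumn n m hmn) N :=
  (columnRelations (twoColumn n m hmn) N).liftQ (etaFree hmn ℓ N)
    (columnRelations_le_ker_etaFree hmn ℓ N)

lemma eta_tabloid {n m : ℕ} (hmn : m ≤ n) (ℓ : ℕ) {N : ℕ} (t : Tableau (twoColumn n m hmn) N) :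
    eta hmn ℓ N (tabloid t) = (m.choose ℓ : ℂ) • tabloid t -
      ∑ A : {A : Finset (Fin n) // A.card = ℓ}, ∑ B : {B : Finset (Fin m) // B.card = ℓ},
        tabloid ((exchange hmn A B).trans t) := by
  simp [eta, tabloid, etaFree, exchangeSum]

lemma eta_equivariant {n m : ℕ} (hmn : m ≤ n) (ℓ N : ℕ) (σ : Perm (Fin N)) :
    eta hmn ℓ N ∘ₗ tabloidRep (twoColumn n m hmn) N σ =
      tabloidRep (twoColumn n m hmn) N σ ∘ₗ eta hmn ℓ N := by
  refine tabloidSpace_hom_ext fun t => ?_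
  simp only [LinearMap.comp_apply, tabloidRep_tabloid, eta_tabloid, map_sub, map_smul, map_sum]
  rfl

/-- The subspace `H^{μ,ℓ}` of `M^μ` generated by the elements `η_ℓ([t])`. -/
def etaSubmodule {n m : ℕ} (hmn : m ≤ n) (ℓ N : ℕ) :
    Submodule ℂ (TabloidSpace (twoColumn n m hmn) N) :=
  Submodule.span ℂ (Set.range fun t : Tableau (twoColumn n m hmn) N => eta hmn ℓ N (tabloid t))

lemma etaSubmodule_invariant {n m : ℕ} (hmn : m ≤ n) (ℓ N : ℕ) (σ : Perm (Fin N)) :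
    etaSubmodule hmn ℓ N ≤
      (etaSubmodule hmn ℓ N).comap (tabloidRep (twoColumn n m hmn) N σ) := by
  refine Submodule.span_le.2 ?_
  rintro _ ⟨t, rfl⟩
  refine Submodule.subset_span ⟨t.trans σ, ?_⟩
  have h := LinearMap.congr_fun (eta_equivariant hmn ℓ N σ) (tabloid t)
  simpa only [LinearMap.comp_apply, tabloidRep_tabloid] using h

/-- The representation of the symmetric group on the quotient `M^μ / H^{μ,ℓ}`. -/
def quotientRep {n m : ℕ} (hmn : m ≤ n) (ℓ N : ℕ) : Representation ℂ (Perm (Fin N))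
    (TabloidSpace (twoColumn n m hmn) N ⧸ etaSubmodule hmn ℓ N) :=
  (tabloidRep (twoColumn n m hmn) N).quotient (etaSubmodule hmn ℓ N)
    (etaSubmodule_invariant hmn ℓ N)

/-- The subspace `H^{μ,ℓ}` is the image of `η_ℓ`. -/
lemma etaSubmodule_eq_range {n m : ℕ} (hmn : m ≤ n) (ℓ N : ℕ) :
    etaSubmodule hmn ℓ N = LinearMap.range (eta hmn ℓ N) := by
  refine le_antisymm (Submodule.span_le.2 ?_) ?_
  · rintro _ ⟨t, rfl⟩
    exact ⟨_, rfl⟩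
  · have h : (etaSubmodule hmn ℓ N).mkQ ∘ₗ eta hmn ℓ N = 0 := by
      refine tabloidSpace_hom_ext fun t => ?_
      rw [LinearMap.comp_apply, LinearMap.zero_apply, Submodule.mkQ_apply,
        Submodule.Quotient.mk_eq_zero]
      exact Submodule.subset_span ⟨t, rfl⟩
    rintro _ ⟨x, rfl⟩
    exact (Submodule.Quotient.mk_eq_zero _).1 (LinearMap.congr_fun h x)

/-- The shape `2^m 1^{n-m}` has `n + m` cells, so it has tableaux with letters `Fin (n + m)`. -/
instance tableau_nonempty {n m : ℕ} (hmn : m ≤ n) : Nonempty (Tableau (twoColumn n m hmn) (n + m)) :=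
  ⟨(cellEquiv n m hmn).symm.trans finSumFinEquiv⟩

/-- The scalar `ω_{ℓ,i}`. -/
def omega (n m ℓ i : ℕ) : ℤ :=
  (m.choose ℓ : ℤ) - ∑ k ∈ Finset.range (ℓ + 1),
    ((m - i).choose k : ℤ) * ((n - i).choose k : ℤ) * (i.choose (ℓ - k) : ℤ) * (-1) ^ k

end TwoColumnSpecht

end

/-! Fix a tableau `t`. A column tabloid is determined up to sign by the set of entries in its second
column, so, after twisting by the sign of the permutation taking `t` to a tableau, $M^\mu$ becomes
the space of functions on $m$-element sets of letters (`sliceEquiv`). An exchange of $\ell$ entries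
moves this set to one at distance $\ell$ in the Johnson scheme and has sign $(-1)^\ell$. Hence
$\eta_\ell$ becomes $\binom m\ell-(-1)^\ell J_\ell$, where $J_\ell$ is the distance-$\ell$ operator
(`sliceEquiv_eta`).

The operators $J_\ell$ have common eigenvectors: the products $\prod(x_b-x_a)$ over $i$ disjoint
pairs of letters, where $x_a(B)$ is 1 if $a\in B$ and 0 otherwise. Peeling off one pair at a time
yields the eigenvalue (`sum_pairProd_exchange`, `johnson_pairFun`), and on the span of these
products $\eta_\ell$ is the scalar $\omega_{\ell,i}$. The spans for $i=0,\dots,m$ fill the space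
(`iSup_pairSpan`) and are nonzero (`pairSpan_ne_bot`). The numbers $\omega_{1,i}$ are distinct, so
the span for $i=m$ meets the sum of the others trivially (`disjoint_component_last`).

The map $x\mapsto x[t]$ embeds the Specht module in $M^\mu$ with image the span for $i=m$
(`orbitMap_injOn`, `map_spechtSubmodule`). Since $\omega_{\ell,m}=0$, the image of $\eta_\ell$ lies
in the sum of the spans for $i<m$. If no $\omega_{\ell,i}$ with $i<m$ vanishes, it equals that sum,
and the quotient is the Specht module. If one vanishes, the kernel of $\eta_\ell$ is strictly larger
than the span for $i=m$, and so the quotient is too big. -/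

noncomputable section

namespace TwoColumnSpecht

open Equiv

/-! ### Products of differences indexed by lists of pairs -/

section Johnson

variable {α : Type*}

/-- The letters occurring in a list of pairs. -/
def letters (L : List (α × α)) : List α := L.flatMap fun p => [p.1, p.2]

@[simp] lemma letters_nil : letters ([] : List (α × α)) = [] := rfl

@[simp] lemma letters_cons (p : α × α) (L : List (α × α)) :
    letters (p :: L) = p.1 :: p.2 :: letters L := rfl

lemma fst_mem_letters {L : List (α × α)} {p : α × α} (hp : p ∈ L) : p.1 ∈ letters L :=
  List.mem_flatMap.2 ⟨p, hp, by simp⟩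

lemma snd_mem_letters {L : List (α × α)} {p : α × α} (hp : p ∈ L) : p.2 ∈ letters L :=
  List.mem_flatMap.2 ⟨p, hp, by simp⟩

lemma length_letters (L : List (α × α)) : (letters L).length = 2 * L.length := by
  induction L with
  | nil => rfl
  | cons p L ih => simp [ih]; ring

lemma letters_map (σ : α → α) (L : List (α × α)) :
    letters (L.map (Prod.map σ σ)) = (letters L).map σ := by
  induction L with
  | nil => rfl
  | cons p L ih => simp [ih]

lemma mem_map_perm (σ : Perm α) (B : Finset α) (x : α) :
    x ∈ B.map σ.toEmbedding ↔ σ.symm x ∈ B := by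
  simp [Finset.mem_map_equiv]

/-- The `m`-element subsets. -/
abbrev Slice (α : Type*) (m : ℕ) : Type _ := {B : Finset α // B.card = m}

/-- Permutations act on `m`-element subsets. -/
def slicePerm {m : ℕ} (σ : Perm α) : Perm (Slice α m) :=
  σ.finsetCongr.subtypeEquiv fun A => by simp

@[simp] lemma coe_slicePerm {m : ℕ} (σ : Perm α) (B : Slice α m) :
    (slicePerm σ B).1 = B.1.map σ.toEmbedding := rfl

variable [DecidableEq α]

/-- The contribution of a pair `(a, b)` to the value at `B`. -/
def pairDiff (p : α × α) (B : Finset α) : ℂ :=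
  (if p.2 ∈ B then 1 else 0) - (if p.1 ∈ B then 1 else 0)

/-- The value at `B` of the product of the differences `x_b - x_a` over the pairs `(a, b)`. -/
def pairProd (L : List (α × α)) (B : Finset α) : ℂ := (L.map fun p => pairDiff p B).prod

@[simp] lemma pairProd_nil (B : Finset α) : pairProd [] B = 1 := rfl

@[simp] lemma pairProd_cons (p : α × α) (L : List (α × α)) (B : Finset α) :
    pairProd (p :: L) B = pairDiff p B * pairProd L B := by
  simp [pairProd]

lemma pairDiff_congr {p : α × α} {B B' : Finset α} (h₁ : p.1 ∈ B ↔ p.1 ∈ B')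
    (h₂ : p.2 ∈ B ↔ p.2 ∈ B') : pairDiff p B = pairDiff p B' := by
  simp [pairDiff, h₁, h₂]

lemma pairProd_congr {L : List (α × α)} {B B' : Finset α}
    (h : ∀ x ∈ letters L, x ∈ B ↔ x ∈ B') : pairProd L B = pairProd L B' := by
  induction L with
  | nil => rfl
  | cons p L ih =>
    simp only [letters_cons, List.mem_cons, forall_eq_or_imp] at h
    rw [pairProd_cons, pairProd_cons, ih h.2.2, pairDiff_congr h.1 h.2.1]

lemma pairProd_map (σ : Perm α) (L : List (α × α)) (B : Finset α) :
    pairProd (L.map (Prod.map σ σ)) (B.map σ.toEmbedding) = pairProd L B := by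
  induction L with
  | nil => rfl
  | cons p L ih =>
    rw [List.map_cons, pairProd_cons, pairProd_cons, ih]
    simp [pairDiff]

/-- The swap reverses one factor and, the letters being distinct, moves no letter of the others. In
particular the product vanishes at every set that contains both or neither letter of some pair,
because the swap fixes such a set. -/
lemma pairProd_map_swap {L : List (α × α)} (hL : (letters L).Nodup) {p : α × α} (hp : p ∈ L)
    (B : Finset α) : pairProd L (B.map (swap p.1 p.2).toEmbedding) = -pairProd L B := by
  induction L with
  | nil => simp at hp
  | cons q L ih =>
    simp only [letters_cons, List.nodup_cons, List.mem_cons, not_or] at hL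
    obtain ⟨⟨h₁, h₂⟩, h₃, h₄⟩ := hL
    rw [pairProd_cons, pairProd_cons]
    rcases List.mem_cons.1 hp with rfl | hp
    · have e : pairProd L (B.map (swap p.1 p.2).toEmbedding) = pairProd L B := by
        refine pairProd_congr fun x hx => ?_
        rw [mem_map_perm, symm_swap, swap_apply_of_ne_of_ne]
        · rintro rfl; exact h₂ hx
        · rintro rfl; exact h₃ hx
      rw [e]
      simp only [pairDiff, mem_map_perm, symm_swap, swap_apply_left, swap_apply_right]
      ring
    · have hne : ∀ x, x ∉ letters L → swap p.1 p.2 x = x := fun x hx =>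
        swap_apply_of_ne_of_ne (fun h => hx (h ▸ fst_mem_letters hp))
          (fun h => hx (h ▸ snd_mem_letters hp))
      rw [ih h₄ hp, pairDiff_congr (B' := B)]
      · ring
      · rw [mem_map_perm, symm_swap, hne _ h₂]
      · rw [mem_map_perm, symm_swap, hne _ h₃]

lemma map_swap_eq_self {a b : α} {B : Finset α} (h : a ∈ B ↔ b ∈ B) :
    B.map (swap a b).toEmbedding = B := by
  ext x
  rw [mem_map_perm, symm_swap, swap_apply_def]
  split_ifs with h₁ h₂
  · rw [h₁, h]
  · rw [h₂, h]
  · rfl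

/-! ### The eigenvalues of the Johnson scheme -/

/-- The eigenvalue of the distance `ℓ` operator of the Johnson scheme on the `i`-th eigenspace,
where `p` and `q` are the sizes of the set and of its complement, both reduced by `i`. -/
def johnsonEigenvalue (i p q ℓ : ℕ) : ℤ :=
  ∑ k ∈ Finset.range (ℓ + 1), (p.choose k : ℤ) * q.choose k * i.choose (ℓ - k) * (-1) ^ (ℓ - k)

lemma johnsonEigenvalue_zero_left (p q ℓ : ℕ) :
    johnsonEigenvalue 0 p q ℓ = p.choose ℓ * q.choose ℓ := by
  rw [johnsonEigenvalue, Finset.sum_eq_single ℓ]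
  · simp
  · intro k hk hne
    rw [Finset.mem_range] at hk
    rw [Nat.choose_eq_zero_of_lt (by omega : 0 < ℓ - k)]
    simp
  · simp

lemma johnsonEigenvalue_zero_right (i p q : ℕ) : johnsonEigenvalue i p q 0 = 1 := by
  simp [johnsonEigenvalue]

/-- Pascal's rule for `(i + 1).choose (ℓ + 1 - k)`; the terms with `k = ℓ + 1` agree on both sides.
This is the recursion produced by peeling off one pair in `sum_pairProd_exchange`. -/
lemma johnsonEigenvalue_succ (i p q ℓ : ℕ) :
    johnsonEigenvalue (i + 1) p q (ℓ + 1) =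
      johnsonEigenvalue i p q (ℓ + 1) - johnsonEigenvalue i p q ℓ := by
  unfold johnsonEigenvalue
  rw [Finset.sum_range_succ, Finset.sum_range_succ (n := ℓ + 1), add_sub_right_comm,
    ← Finset.sum_sub_distrib]
  congr 1
  · refine Finset.sum_congr rfl fun k hk => ?_
    rw [Finset.mem_range] at hk
    rw [Nat.sub_add_comm (by omega : k ≤ ℓ), Nat.choose_succ_succ]
    push_cast
    ring
  · simp

/-- The two sign conventions differ by $(-1)^\ell$, which is the sign of an exchange of $\ell$
entries. -/
lemma omega_eq (n m ℓ i : ℕ) :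
    omega n m ℓ i = m.choose ℓ - (-1) ^ ℓ * johnsonEigenvalue i (m - i) (n - i) ℓ := by
  rw [omega, johnsonEigenvalue, Finset.mul_sum]
  congr 1
  refine Finset.sum_congr rfl fun k hk => ?_
  have : ((-1 : ℤ)) ^ k = (-1) ^ ℓ * (-1) ^ (ℓ - k) := by
    obtain ⟨d, rfl⟩ := Nat.exists_eq_add_of_le (Nat.lt_succ_iff.1 (Finset.mem_range.1 hk))
    rw [Nat.add_sub_cancel_left, pow_add, mul_assoc, ← pow_add, ← two_mul, pow_mul]
    simp
  rw [this]
  ring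

lemma sum_powersetCard_succ_insert {x : α} {s : Finset α} (h : x ∉ s) (k : ℕ)
    (F : Finset α → ℂ) :
    ∑ A ∈ (insert x s).powersetCard (k + 1), F A =
      ∑ A ∈ s.powersetCard (k + 1), F A + ∑ A ∈ s.powersetCard k, F (insert x A) := by
  have hn : ∀ A ∈ s.powersetCard k, x ∉ A := fun A hA hx =>
    h ((Finset.mem_powersetCard.1 hA).1 hx)
  rw [Finset.powersetCard_succ_insert h, Finset.sum_union, Finset.sum_image]
  · intro A hA A' hA' e
    rw [← Finset.erase_insert (hn A hA), ← Finset.erase_insert (hn A' hA'), e]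
  · rw [Finset.disjoint_left]
    intro A hA hA'
    obtain ⟨C, -, rfl⟩ := Finset.mem_image.1 hA'
    exact h ((Finset.mem_powersetCard.1 hA).1 (Finset.mem_insert_self _ _))

/-- Induction on the pairs. Let `x ∈ B` and `y ∉ B` be the letters of the first pair. If exactly one
of "`x` leaves" and "`y` enters" happens, the new set contains both or neither, and the factor is 0.
If neither happens the factor is unchanged; if both happen it changes sign and only `ℓ - 1` further
exchanges remain. This matches `johnsonEigenvalue_succ`. The pools `P` and `Q` of letters allowed to
leave and to enter are kept general because each step deletes `x` and `y` from them; `p` and `q`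
stay constant. -/
lemma sum_pairProd_exchange {L : List (α × α)} (hL : (letters L).Nodup) {B : Finset α}
    (hB : ∀ p ∈ L, ¬(p.1 ∈ B ↔ p.2 ∈ B)) {P Q : Finset α} (hP : P ⊆ B) (hQ : Disjoint Q B)
    (hLP : ∀ x ∈ letters L, x ∈ B → x ∈ P) (hLQ : ∀ x ∈ letters L, x ∉ B → x ∈ Q) {p q : ℕ}
    (hp : P.card = p + L.length) (hq : Q.card = q + L.length) (ℓ : ℕ) :
    ∑ A ∈ Q.powersetCard ℓ, ∑ C ∈ P.powersetCard ℓ, pairProd L ((B \ C) ∪ A) =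
      johnsonEigenvalue L.length p q ℓ * pairProd L B := by
  induction L generalizing P Q ℓ with
  | nil =>
    simp only [List.length_nil, Nat.add_zero] at hp hq
    simp [johnsonEigenvalue_zero_left, hp, hq, mul_comm]
  | cons r L ih =>
    rcases ℓ with _ | ℓ
    · simp [johnsonEigenvalue_zero_right]
    simp only [letters_cons, List.nodup_cons, List.mem_cons, not_or, forall_eq_or_imp] at hL hB hLP hLQ
    obtain ⟨⟨h₁, h₂⟩, h₃, h₄⟩ := hL
    -- The sign `s` absorbs the orientation of the pair, so that `x` is always the letter inside
    -- `B`.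
    obtain ⟨x, y, s, hx, hy, hxL, hyL, hxP, hyQ, hs⟩ : ∃ (x y : α) (s : ℂ), x ∈ B ∧ y ∉ B ∧
        x ∉ letters L ∧ y ∉ letters L ∧ x ∈ P ∧ y ∈ Q ∧ ∀ B' : Finset α,
          pairDiff r B' = s * ((if x ∈ B' then 1 else 0) - (if y ∈ B' then 1 else 0)) := by
      by_cases h : r.2 ∈ B
      · have h' : r.1 ∉ B := fun h' => hB.1 (by simp [h, h'])
        exact ⟨r.2, r.1, 1, h, h', h₃, h₂, hLP.2.1 h, hLQ.1 h', fun B' => by simp [pairDiff]⟩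
      · have h' : r.1 ∈ B := by
          by_contra h'
          exact hB.1 (by simp [h, h'])
        exact ⟨r.1, r.2, -1, h', h, h₂, h₃, hLP.1 h', hLQ.2.1 h, fun B' => by simp [pairDiff]⟩
    have hxy : x ≠ y := fun h => hy (h ▸ hx)
    set P' := P.erase x with hP'
    set Q' := Q.erase y with hQ'
    have hPi : P = insert x P' := (Finset.insert_erase hxP).symm
    have hQi : Q = insert y Q' := (Finset.insert_erase hyQ).symm
    have hxP' : x ∉ P' := Finset.notMem_erase _ _
    have hyQ' : y ∉ Q' := Finset.notMem_erase _ _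
    have hP'B : P' ⊆ B := (Finset.erase_subset _ _).trans hP
    have hQ'B : Disjoint Q' B := hQ.mono_left (Finset.erase_subset _ _)
    have IH := ih h₄ hB.2 hP'B hQ'B
      (fun z hz hzB => Finset.mem_erase.2 ⟨fun h => hxL (h ▸ hz), hLP.2.2 z hz hzB⟩)
      (fun z hz hzB => Finset.mem_erase.2 ⟨fun h => hyL (h ▸ hz), hLQ.2.2 z hz hzB⟩)
      (by rw [hP', Finset.card_erase_of_mem hxP, hp, List.length_cons]; omega)
      (by rw [hQ', Finset.card_erase_of_mem hyQ, hq, List.length_cons]; omega)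
    -- `u` records whether `x` leaves and `v` whether `y` enters; `e₁` to `e₄` are the four cases.
    have key : ∀ A ⊆ Q', ∀ C ⊆ P', ∀ (u v : Bool),
        pairProd (r :: L) ((B \ (if u then insert x C else C)) ∪ (if v then insert y A else A)) =
          s * ((if u then 0 else 1) - (if v then 1 else 0)) * pairProd L ((B \ C) ∪ A) := by
      intro A hA C hC u v
      have hxA : x ∉ A := fun h => Finset.disjoint_left.1 hQ'B (hA h) hx
      have hyA : y ∉ A := fun h => hyQ' (hA h)
      have hxC : x ∉ C := fun h => hxP' (hC h)
      rw [pairProd_cons, hs]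
      congr 1
      · cases u <;> cases v <;> simp [hx, hy, hxA, hyA, hxC, hxy]
      · refine pairProd_congr fun z hz => ?_
        have hzx : z ≠ x := fun h => hxL (h ▸ hz)
        have hzy : z ≠ y := fun h => hyL (h ▸ hz)
        cases u <;> cases v <;> simp [hzx, hzy]
    rw [hQi, hPi, sum_powersetCard_succ_insert hyQ']
    simp only [sum_powersetCard_succ_insert hxP']
    have e₁ : ∀ k k', ∀ A ∈ Q'.powersetCard k, ∀ C ∈ P'.powersetCard k',
        pairProd (r :: L) ((B \ C) ∪ A) = s * pairProd L ((B \ C) ∪ A) := by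
      intro k k' A hA C hC
      simpa using key A (Finset.mem_powersetCard.1 hA).1 C (Finset.mem_powersetCard.1 hC).1
        false false
    have e₂ : ∀ k k', ∀ A ∈ Q'.powersetCard k, ∀ C ∈ P'.powersetCard k',
        pairProd (r :: L) ((B \ insert x C) ∪ A) = 0 := by
      intro k k' A hA C hC
      simpa using key A (Finset.mem_powersetCard.1 hA).1 C (Finset.mem_powersetCard.1 hC).1
        true false
    have e₃ : ∀ k k', ∀ A ∈ Q'.powersetCard k, ∀ C ∈ P'.powersetCard k',
        pairProd (r :: L) ((B \ C) ∪ insert y A) = 0 := by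
      intro k k' A hA C hC
      simpa using key A (Finset.mem_powersetCard.1 hA).1 C (Finset.mem_powersetCard.1 hC).1
        false true
    have e₄ : ∀ k k', ∀ A ∈ Q'.powersetCard k, ∀ C ∈ P'.powersetCard k',
        pairProd (r :: L) ((B \ insert x C) ∪ insert y A) = -s * pairProd L ((B \ C) ∪ A) := by
      intro k k' A hA C hC
      simpa using key A (Finset.mem_powersetCard.1 hA).1 C (Finset.mem_powersetCard.1 hC).1
        true true
    have hr : pairProd (r :: L) B = s * pairProd L B := by
      rw [pairProd_cons, hs]; simp [hx, hy]
    rw [hr, List.length_cons, johnsonEigenvalue_succ]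
    have s₁ := IH (ℓ + 1)
    have s₂ := IH ℓ
    calc _ = ∑ A ∈ Q'.powersetCard (ℓ + 1), (∑ C ∈ P'.powersetCard (ℓ + 1),
            s * pairProd L ((B \ C) ∪ A) + ∑ C ∈ P'.powersetCard ℓ, 0) +
          ∑ A ∈ Q'.powersetCard ℓ, (∑ C ∈ P'.powersetCard (ℓ + 1), 0 +
            ∑ C ∈ P'.powersetCard ℓ, -s * pairProd L ((B \ C) ∪ A)) := by
          congr 1 <;> refine Finset.sum_congr rfl fun A hA => ?_
          · exact congrArg₂ _ (Finset.sum_congr rfl (e₁ _ _ A hA))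
              (Finset.sum_congr rfl (e₂ _ _ A hA))
          · exact congrArg₂ _ (Finset.sum_congr rfl (e₃ _ _ A hA))
              (Finset.sum_congr rfl (e₄ _ _ A hA))
      _ = _ := by
          simp only [Finset.sum_const_zero, add_zero, zero_add, ← Finset.mul_sum, s₁, s₂]
          push_cast
          ring

/-! ### The distance operators on functions on `m`-element sets -/

/-- The function `B ↦ ∏ (x_b - x_a)` on `m`-element sets. -/
def pairFun (m : ℕ) (L : List (α × α)) : Slice α m → ℂ := fun B => pairProd L B.1

lemma pairFun_slicePerm_swap {m : ℕ} {L : List (α × α)} (hL : (letters L).Nodup) {p : α × α}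
    (hp : p ∈ L) (B : Slice α m) : pairFun m L (slicePerm (swap p.1 p.2) B) = -pairFun m L B :=
  pairProd_map_swap hL hp B.1

lemma slicePerm_swap_eq_self {m : ℕ} {a b : α} {B : Slice α m} (h : a ∈ B.1 ↔ b ∈ B.1) :
    slicePerm (swap a b) B = B :=
  Subtype.ext (map_swap_eq_self h)

/-- Each separated pair contributes exactly one letter. Applied to a set and to its complement, this
bounds the number of pairs by both sizes. -/
lemma card_letters_inter_of_separated {L : List (α × α)} (hL : (letters L).Nodup) {B : Finset α}
    (hB : ∀ p ∈ L, ¬(p.1 ∈ B ↔ p.2 ∈ B)) :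
    ((letters L).toFinset ∩ B).card = L.length := by
  induction L with
  | nil => simp
  | cons r L ih =>
    simp only [letters_cons, List.nodup_cons, List.mem_cons, not_or, forall_eq_or_imp] at hL hB
    obtain ⟨⟨h₁, h₂⟩, h₃, h₄⟩ := hL
    have IH := ih h₄ hB.2
    simp only [letters_cons, List.toFinset_cons, List.length_cons, ← IH]
    by_cases h : r.1 ∈ B
    · have h' : r.2 ∉ B := fun h' => hB.1 (by simp [h, h'])
      rw [Finset.insert_inter_of_mem h, Finset.insert_inter_of_notMem h',
        Finset.card_insert_of_notMem (by simp [h₂])]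
    · have h' : r.2 ∈ B := by
        by_contra h'
        exact hB.1 (by simp [h, h'])
      rw [Finset.insert_inter_of_notMem h, Finset.insert_inter_of_mem h',
        Finset.card_insert_of_notMem (by simp [h₃])]

variable [Fintype α]

/-- The sum over all sets at distance `ℓ` in the Johnson scheme. -/
def johnson (α : Type*) [DecidableEq α] [Fintype α] (m ℓ : ℕ) :
    (Slice α m → ℂ) →ₗ[ℂ] (Slice α m → ℂ) where
  toFun f B := ∑ B' : Slice α m, if (B.1 \ B'.1).card = ℓ then f B' else 0
  map_add' f g := by
    ext B
    simp only [Pi.add_apply, ← Finset.sum_add_distrib]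
    exact Finset.sum_congr rfl fun B' _ => by split_ifs <;> simp
  map_smul' c f := by
    ext B
    simp only [Pi.smul_apply, smul_eq_mul, Finset.mul_sum, RingHom.id_apply]
    exact Finset.sum_congr rfl fun B' _ => by split_ifs <;> simp

lemma johnson_apply {m ℓ : ℕ} (f : Slice α m → ℂ) (B : Slice α m) :
    johnson α m ℓ f B = ∑ B' : Slice α m, if (B.1 \ B'.1).card = ℓ then f B' else 0 := rfl

/-- A set `B'` is recovered from the letters that enter, `B' \ B`, and those that leave, `B \ B'`;
both have the same number because `B` and `B'` have equal size. -/
lemma sum_slice_eq_sum_exchange {m ℓ : ℕ} (F : Finset α → ℂ) (B : Slice α m) :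
    ∑ B' : Slice α m, (if (B.1 \ B'.1).card = ℓ then F B'.1 else 0) =
      ∑ A ∈ B.1ᶜ.powersetCard ℓ, ∑ C ∈ B.1.powersetCard ℓ, F ((B.1 \ C) ∪ A) := by
  rw [← Finset.sum_product', ← Finset.sum_filter]
  symm
  have hc : ∀ x ∈ B.1ᶜ.powersetCard ℓ ×ˢ B.1.powersetCard ℓ, ((B.1 \ x.2) ∪ x.1).card = m := by
    intro x hx
    simp only [Finset.mem_product, Finset.mem_powersetCard] at hx
    obtain ⟨⟨h₁, h₂⟩, h₃, h₄⟩ := hx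
    rw [Finset.card_union_of_disjoint, Finset.card_sdiff_of_subset h₃, h₂, h₄]
    · have := Finset.card_le_card h₃
      have := B.2
      omega
    · rw [Finset.disjoint_left]
      intro y hy hy'
      exact Finset.mem_compl.1 (h₁ hy') (Finset.mem_sdiff.1 hy).1
  refine Finset.sum_bij' (fun x hx => ⟨(B.1 \ x.2) ∪ x.1, hc x hx⟩)
    (fun B' _ => (B'.1 \ B.1, B.1 \ B'.1)) ?_ ?_ ?_ ?_ ?_
  · intro x hx
    simp only [Finset.mem_product, Finset.mem_powersetCard] at hx
    obtain ⟨⟨h₁, h₂⟩, h₃, h₄⟩ := hx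
    simp only [Finset.mem_filter, Finset.mem_univ, true_and]
    rw [← h₄]
    congr 1
    ext y
    have := @h₁ y
    have := @h₃ y
    simp only [Finset.mem_sdiff, Finset.mem_union, Finset.mem_compl] at *
    tauto
  · intro B' hB'
    simp only [Finset.mem_filter, Finset.mem_univ, true_and] at hB'
    have h := Finset.card_sdiff_add_card_inter B.1 B'.1
    have h' := Finset.card_sdiff_add_card_inter B'.1 B.1
    rw [Finset.inter_comm, B'.2] at h'
    rw [B.2] at h
    simp only [Finset.mem_product, Finset.mem_powersetCard, Finset.sdiff_subset, hB', and_true]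
    refine ⟨fun y hy => ?_, by omega⟩
    exact Finset.mem_compl.2 (Finset.mem_sdiff.1 hy).2
  · intro x hx
    simp only [Finset.mem_product, Finset.mem_powersetCard] at hx
    obtain ⟨⟨h₁, h₂⟩, h₃, h₄⟩ := hx
    ext y
    · have := @h₁ y
      have := @h₃ y
      simp only [Finset.mem_sdiff, Finset.mem_union, Finset.mem_compl] at *
      tauto
    · have := @h₁ y
      have := @h₃ y
      simp only [Finset.mem_sdiff, Finset.mem_union, Finset.mem_compl] at *
      tauto
  · intro B' hB'
    ext y
    simp only [Finset.mem_sdiff, Finset.mem_union]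
    tauto
  · intro x hx
    rfl

lemma johnson_comp_slicePerm {m ℓ : ℕ} (σ : Perm α) (f : Slice α m → ℂ) (B : Slice α m) :
    johnson α m ℓ f (slicePerm σ B) = johnson α m ℓ (f ∘ slicePerm σ) B := by
  rw [johnson_apply, johnson_apply, ← Equiv.sum_comp (slicePerm σ)]
  refine Finset.sum_congr rfl fun B' _ => ?_
  have : ((slicePerm σ B).1 \ (slicePerm σ B').1).card = (B.1 \ B'.1).card := by
    rw [coe_slicePerm, coe_slicePerm, ← Finset.map_sdiff, Finset.card_map]
  rw [this]
  rfl

/-- At a set separating all pairs this is `sum_pairProd_exchange` with the largest pools, and the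
subtractions are not truncated because such a set and its complement each contain one letter of
every pair. At any other set both sides vanish: some swap fixes the set but negates the product,
hence also its image, since the operator commutes with permutations. -/
lemma johnson_pairFun {m n ℓ : ℕ} (hα : Fintype.card α = n + m) {L : List (α × α)}
    (hL : (letters L).Nodup) :
    johnson α m ℓ (pairFun m L) =
      (johnsonEigenvalue L.length (m - L.length) (n - L.length) ℓ : ℂ) • pairFun m L := by
  ext B
  rw [Pi.smul_apply, smul_eq_mul]
  by_cases hB : ∀ p ∈ L, ¬(p.1 ∈ B.1 ↔ p.2 ∈ B.1)
  · have c₁ := card_letters_inter_of_separated hL hB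
    have c₂ := card_letters_inter_of_separated hL (B := B.1ᶜ) (by simpa [not_iff_not] using hB)
    have c₃ := Finset.card_le_card
      (Finset.inter_subset_right : (letters L).toFinset ∩ B.1 ⊆ B.1)
    have c₄ := Finset.card_le_card
      (Finset.inter_subset_right : (letters L).toFinset ∩ B.1ᶜ ⊆ B.1ᶜ)
    have c₅ : B.1ᶜ.card = n := by rw [Finset.card_compl, hα, B.2]; omega
    rw [c₁, B.2] at c₃
    rw [c₂, c₅] at c₄
    rw [johnson_apply]
    refine (sum_slice_eq_sum_exchange (pairProd L) B).trans ?_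
    exact sum_pairProd_exchange hL hB subset_rfl (disjoint_compl_left) (fun _ _ h => h)
      (fun _ _ h => Finset.mem_compl.2 h) (by rw [B.2]; omega) (by omega) ℓ
  · push Not at hB
    obtain ⟨p, hp, h⟩ := hB
    have hself := slicePerm_swap_eq_self h
    have e₁ := pairFun_slicePerm_swap hL hp B
    have e₂ := johnson_comp_slicePerm (ℓ := ℓ) (swap p.1 p.2) (pairFun m L) B
    have e₃ : pairFun m L ∘ slicePerm (swap p.1 p.2) = -pairFun m L :=
      funext fun B' => pairFun_slicePerm_swap hL hp B'
    rw [hself] at e₁ e₂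
    rw [e₃, map_neg, Pi.neg_apply] at e₂
    rw [self_eq_neg.1 e₁, self_eq_neg.1 e₂, mul_zero]

end Johnson

/-! ### Spanning the functions on `m`-element sets by products of differences -/

section Johnson

variable {α : Type*}

lemma letters_injective : Function.Injective (letters : List (α × α) → List α) := by
  intro L L' h
  induction L generalizing L' with
  | nil => cases L' with
    | nil => rfl
    | cons q L' => simp at h
  | cons p L ih => cases L' with
    | nil => simp at h
    | cons q L' =>
      simp only [letters_cons, List.cons.injEq] at h
      rw [ih h.2.2, Prod.ext h.1 h.2.1]

lemma letters_perm (L : List (α × α)) :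
    (letters L).Perm (L.map Prod.fst ++ L.map Prod.snd) := by
  induction L with
  | nil => simp
  | cons p L ih =>
    simp only [letters_cons, List.map_cons, List.cons_append]
    refine List.Perm.cons _ ((List.Perm.cons _ ih).trans ?_)
    exact List.perm_middle.symm

lemma nodup_letters_iff {L : List (α × α)} : (letters L).Nodup ↔
    (L.map Prod.fst).Nodup ∧ (L.map Prod.snd).Nodup ∧ ∀ p ∈ L, ∀ q ∈ L, p.1 ≠ q.2 := by
  rw [(letters_perm L).nodup_iff, List.nodup_append]
  simp only [List.mem_map, forall_exists_index, and_imp, forall_apply_eq_imp_iff₂]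

lemma nodup_letters_ofFn {k : ℕ} {a b : Fin k → α} (ha : Function.Injective a)
    (hb : Function.Injective b) (hab : ∀ i j, a i ≠ b j) :
    (letters ((List.finRange k).map fun j => (a j, b j))).Nodup := by
  rw [nodup_letters_iff]
  simp only [List.map_map, List.mem_map]
  refine ⟨(List.nodup_finRange k).map ha, (List.nodup_finRange k).map hb, ?_⟩
  rintro _ ⟨i, -, rfl⟩ _ ⟨j, -, rfl⟩
  exact hab i j

lemma exists_perm_map_eq {l l' : List α} (hl : l.Nodup) (hl' : l'.Nodup)
    (h : l.length = l'.length) : ∃ σ : Perm α, l.map σ = l' := by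
  obtain ⟨σ, hσ⟩ := Equiv.Perm.exists_extending_pair l.get (l'.get ∘ Fin.cast h)
    (List.nodup_iff_injective_get.1 hl)
    ((List.nodup_iff_injective_get.1 hl').comp (Fin.cast_injective h))
  refine ⟨σ, List.ext_getElem (by simpa using h) fun i h₁ h₂ => ?_⟩
  rw [List.getElem_map]
  exact hσ ⟨i, by simpa using h₁⟩

variable [DecidableEq α]

/-- The span of the products of `i` differences of letters. -/
def pairSpan (α : Type*) [DecidableEq α] (m i : ℕ) : Submodule ℂ (Slice α m → ℂ) :=
  Submodule.span ℂ {f | ∃ L : List (α × α), (letters L).Nodup ∧ L.length = i ∧ f = pairFun m L}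

/-- The product of differences over `L`, times the indicator of the sets containing `C`. -/
def pairSetFun (m : ℕ) (L : List (α × α)) (C : Finset α) : Slice α m → ℂ :=
  fun B => if C ⊆ B.1 then pairProd L B.1 else 0

/-- The span of the products of `i` differences of letters and `m - i` further letters. -/
def pairSetSpan (α : Type*) [DecidableEq α] (m i : ℕ) : Submodule ℂ (Slice α m → ℂ) :=
  Submodule.span ℂ {f | ∃ (L : List (α × α)) (C : Finset α), (letters L).Nodup ∧ L.length = i ∧
    i + C.card = m ∧ (∀ x ∈ C, x ∉ letters L) ∧ f = pairSetFun m L C}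

/-- Elements of `C` are replaced by elements of `C'` one at a time. Replacing `x` by `y` changes the
function by a multiple of $x_x-x_y$, which supplies one more pair and leaves one letter fewer in the
set. -/
lemma pairSetFun_sub_mem {m : ℕ} {L : List (α × α)} (hL : (letters L).Nodup) {C C' : Finset α}
    (hC : L.length + C.card = m) (hC' : C'.card = C.card) (hCL : ∀ x ∈ C, x ∉ letters L)
    (hCL' : ∀ x ∈ C', x ∉ letters L) :
    pairSetFun m L C - pairSetFun m L C' ∈ pairSetSpan α m (L.length + 1) := by
  induction h : (C \ C').card using Nat.strong_induction_on generalizing C with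
  | _ k ih =>
    by_cases hs : C ⊆ C'
    · rw [Finset.eq_of_subset_of_card_le hs hC'.le, sub_self]
      exact Submodule.zero_mem _
    · obtain ⟨x, hx, hx'⟩ := Finset.not_subset.1 hs
      obtain ⟨y, hy, hy'⟩ : ∃ y ∈ C', y ∉ C := by
        refine Finset.not_subset.1 fun hs' => hs ?_
        rw [Finset.eq_of_subset_of_card_le hs' hC'.ge]
      have hyx : y ≠ x := fun e => hx' (e ▸ hy)
      have hyE : y ∉ C.erase x := fun e => hy' (Finset.mem_of_mem_erase e)
      have hcard : (insert y (C.erase x)).card = C.card := by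
        rw [Finset.card_insert_of_notMem hyE, Finset.card_erase_add_one hx]
      have h₁ := ih ((insert y (C.erase x)) \ C').card (by
        rw [← h, Finset.insert_sdiff_of_mem _ hy]
        refine Finset.card_lt_card ⟨Finset.sdiff_subset_sdiff (Finset.erase_subset _ _) subset_rfl,
          fun hcon => ?_⟩
        simpa using hcon (Finset.mem_sdiff.2 ⟨hx, hx'⟩)) (C := insert y (C.erase x))
        (by rw [hcard, hC]) (by rw [hcard, hC'])
        (by
          intro z hz
          rcases Finset.mem_insert.1 hz with rfl | hz
          · exact hCL' _ hy
          · exact hCL _ (Finset.mem_of_mem_erase hz)) rfl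
      have h₂ : pairSetFun m L C - pairSetFun m L (insert y (C.erase x)) ∈
          pairSetSpan α m (L.length + 1) := by
        refine Submodule.subset_span ⟨(y, x) :: L, C.erase x, ?_, rfl, ?_, ?_, ?_⟩
        · simp only [letters_cons, List.nodup_cons, List.mem_cons, not_or]
          exact ⟨⟨hyx, hCL' y hy⟩, hCL x hx, hL⟩
        · rw [← hC, ← Finset.card_erase_add_one hx]; ring
        · intro z hz
          simp only [letters_cons, List.mem_cons, not_or]
          exact ⟨fun e => hyE (e ▸ hz), Finset.ne_of_mem_erase hz,
            hCL z (Finset.mem_of_mem_erase hz)⟩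
        · ext B
          have e : C ⊆ B.1 ↔ x ∈ B.1 ∧ C.erase x ⊆ B.1 := by
            rw [← Finset.insert_subset_iff, Finset.insert_erase hx]
          simp only [pairSetFun, Pi.sub_apply, e, Finset.insert_subset_iff, pairProd_cons, pairDiff]
          by_cases h₁ : C.erase x ⊆ B.1 <;> by_cases h₂ : x ∈ B.1 <;> by_cases h₃ : y ∈ B.1 <;>
            simp [h₁, h₂, h₃]
      simpa using Submodule.add_mem _ h₂ h₁

lemma pairProd_eq_one {L : List (α × α)} {B : Finset α} (h₁ : ∀ p ∈ L, p.1 ∉ B)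
    (h₂ : ∀ p ∈ L, p.2 ∈ B) : pairProd L B = 1 := by
  refine List.prod_eq_one fun c hc => ?_
  obtain ⟨p, hp, rfl⟩ := List.mem_map.1 hc
  simp [pairDiff, h₁ p hp, h₂ p hp]

/-- A set that fails to separate some pair is fixed by its swap, so `g` is 0 there. A separating set
is carried to `B₀` by swapping its first letters away one by one, at the cost of signs only. -/
lemma eq_zero_of_antisymmetric {m : ℕ} {L : List (α × α)} (hL : (letters L).Nodup) {g : Slice α m → ℂ}
    (hg : ∀ p ∈ L, ∀ B, g (slicePerm (swap p.1 p.2) B) = -g B)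
    {B₀ : Slice α m} (hB₀ : B₀.1 = (L.map Prod.snd).toFinset) (h₀ : g B₀ = 0) : g = 0 := by
  obtain ⟨-, -, hd⟩ := nodup_letters_iff.1 hL
  ext B
  induction h : ((L.map Prod.fst).toFinset ∩ B.1).card using Nat.strong_induction_on
    generalizing B with
  | _ k ih =>
    by_cases hsep : ∀ p ∈ L, ¬(p.1 ∈ B.1 ↔ p.2 ∈ B.1)
    · by_cases ha : ∃ p ∈ L, p.1 ∈ B.1
      · obtain ⟨p, hp, hpB⟩ := ha
        have hpB' : p.2 ∉ B.1 := fun h' => hsep p hp (by simp [hpB, h'])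
        have e : (L.map Prod.fst).toFinset ∩ (slicePerm (swap p.1 p.2) B).1 =
            ((L.map Prod.fst).toFinset ∩ B.1).erase p.1 := by
          ext x
          simp only [Finset.mem_inter, Finset.mem_erase, coe_slicePerm, mem_map_perm, symm_swap]
          by_cases hx : x = p.1
          · simp [hx, hpB']
          · by_cases hx₂ : x = p.2
            · have : p.2 ∉ (L.map Prod.fst).toFinset := by
                simp only [List.mem_toFinset, List.mem_map, not_exists, not_and]
                exact fun q hq => hd q hq p hp
              simp only [hx₂, this, false_and, and_false]
            · simp [swap_apply_of_ne_of_ne hx hx₂, hx]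
        have hlt := Finset.card_erase_lt_of_mem (s := (L.map Prod.fst).toFinset ∩ B.1)
          (Finset.mem_inter.2 ⟨List.mem_toFinset.2 (List.mem_map_of_mem hp), hpB⟩)
        rw [h] at hlt
        have := ih _ hlt (slicePerm (swap p.1 p.2) B) (by rw [e])
        rw [hg p hp] at this
        simpa using this
      · push Not at ha
        have : B₀ = B := by
          refine Subtype.ext (Finset.eq_of_subset_of_card_le ?_ (by rw [B.2, B₀.2]))
          intro x hx
          rw [hB₀, List.mem_toFinset, List.mem_map] at hx
          obtain ⟨p, hp, rfl⟩ := hx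
          by_contra hcon
          exact hsep p hp (by simp [ha p hp, hcon])
        rw [← this, h₀]; rfl
    · push Not at hsep
      obtain ⟨p, hp, h'⟩ := hsep
      have := hg p hp B
      rw [slicePerm_swap_eq_self h'] at this
      exact self_eq_neg.1 this

/-- A function that changes sign under the swaps of `m` disjoint pairs is a multiple of a product of
differences. -/
lemma eq_smul_pairFun {m : ℕ} {L : List (α × α)} (hL : (letters L).Nodup)
    {g : Slice α m → ℂ} (hg : ∀ p ∈ L, ∀ B, g (slicePerm (swap p.1 p.2) B) = -g B)
    {B₀ : Slice α m} (hB₀ : B₀.1 = (L.map Prod.snd).toFinset) : g = g B₀ • pairFun m L := by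
  obtain ⟨-, -, hd⟩ := nodup_letters_iff.1 hL
  have h₁ : pairFun m L B₀ = 1 := by
    refine pairProd_eq_one (fun p hp h => ?_) fun p hp => ?_
    · rw [hB₀, List.mem_toFinset, List.mem_map] at h
      obtain ⟨q, hq, h⟩ := h
      exact hd p hp q hq h.symm
    · rw [hB₀, List.mem_toFinset]
      exact List.mem_map_of_mem hp
  refine sub_eq_zero.1 (eq_zero_of_antisymmetric hL (fun p hp B => ?_) hB₀ ?_)
  · simp only [Pi.sub_apply, Pi.smul_apply, smul_eq_mul, hg p hp, pairFun_slicePerm_swap hL hp]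
    ring
  · simp [h₁]

variable [Fintype α]

/-- A set `B` separating all pairs has exactly `c` elements that are not letters of `L`, so exactly
one `C` contributes. At other sets the product is already 0. -/
lemma sum_pairSetFun {m c : ℕ} {L : List (α × α)} (hL : (letters L).Nodup)
    (hc : L.length + c = m) :
    ∑ C ∈ ((letters L).toFinsetᶜ).powersetCard c, pairSetFun m L C = pairFun m L := by
  ext B
  rw [Finset.sum_apply]
  simp only [pairSetFun, pairFun, ← Finset.sum_filter]
  by_cases hB : ∀ p ∈ L, ¬(p.1 ∈ B.1 ↔ p.2 ∈ B.1)
  · have h₁ := card_letters_inter_of_separated hL hB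
    have h₂ : ((letters L).toFinsetᶜ.powersetCard c).filter (· ⊆ B.1) =
        (B.1 \ (letters L).toFinset).powersetCard c := by
      ext C
      simp only [Finset.mem_filter, Finset.mem_powersetCard, Finset.subset_iff, Finset.mem_compl,
        Finset.mem_sdiff]
      exact ⟨fun h => ⟨fun x hx => ⟨h.2 hx, h.1.1 hx⟩, h.1.2⟩,
        fun h => ⟨⟨fun x hx => (h.1 hx).2, h.2⟩, fun x hx => (h.1 hx).1⟩⟩
    have h₃ : (B.1 \ (letters L).toFinset).card = c := by
      have := Finset.card_sdiff_add_card_inter B.1 (letters L).toFinset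
      rw [Finset.inter_comm, h₁, B.2] at this
      omega
    rw [h₂, Finset.sum_const, Finset.card_powersetCard, h₃, Nat.choose_self, one_smul]
  · push Not at hB
    obtain ⟨p, hp, h⟩ := hB
    have e := pairFun_slicePerm_swap hL hp B
    rw [slicePerm_swap_eq_self h] at e
    have e' : pairProd L B.1 = 0 := self_eq_neg.1 e
    simp [e']

/-- Averaging over all admissible sets `D` of the size of `C` gives a multiple of `pairFun m L`, and
the error terms are the differences handled by `pairSetFun_sub_mem`. -/
lemma pairSetSpan_le (m i : ℕ) :
    pairSetSpan α m i ≤ pairSpan α m i ⊔ pairSetSpan α m (i + 1) := by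
  refine Submodule.span_le.2 ?_
  rintro _ ⟨L, C, hL, rfl, hC, hCL, rfl⟩
  set S := ((letters L).toFinsetᶜ).powersetCard C.card with hS
  have hmem : ∀ {D : Finset α}, D ∈ S ↔ (∀ x ∈ D, x ∉ letters L) ∧ D.card = C.card := by
    intro D
    simp [hS, Finset.mem_powersetCard, Finset.subset_iff]
  have h₀ : (S.card : ℂ) ≠ 0 := by
    rw [Nat.cast_ne_zero]
    exact Finset.card_ne_zero_of_mem (hmem.2 ⟨hCL, rfl⟩)
  have h₁ : (S.card : ℂ) • pairSetFun m L C =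
      pairFun m L + ∑ D ∈ S, (pairSetFun m L C - pairSetFun m L D) := by
    rw [Finset.sum_sub_distrib, sum_pairSetFun hL hC, Finset.sum_const, add_sub_cancel,
      Nat.cast_smul_eq_nsmul]
  refine (Submodule.smul_mem_iff _ h₀).1 ?_
  rw [h₁]
  refine Submodule.add_mem_sup (Submodule.subset_span ⟨L, hL, rfl, rfl⟩)
    (Submodule.sum_mem _ fun D hD => ?_)
  exact pairSetFun_sub_mem hL hC (hmem.1 hD).2 hCL (hmem.1 hD).1

lemma pairSetSpan_zero (m : ℕ) : pairSetSpan α m 0 = ⊤ := by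
  refine eq_top_iff.2 ?_
  rw [← (Pi.basisFun ℂ (Slice α m)).span_eq]
  refine Submodule.span_mono ?_
  rintro _ ⟨B, rfl⟩
  refine ⟨[], B.1, by simp, rfl, by simp [B.2], by simp, ?_⟩
  ext B'
  rw [Pi.basisFun_apply, Pi.single_apply]
  have : B.1 ⊆ B'.1 ↔ B' = B :=
    ⟨fun h => (Subtype.ext (Finset.eq_of_subset_of_card_le h (by rw [B.2, B'.2]))).symm,
      fun h => h ▸ subset_rfl⟩
  simp [pairSetFun, this]

/-- The spans of the products of at most `m` differences fill the space of functions. -/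
lemma iSup_pairSpan (m : ℕ) : ⨆ i : Fin (m + 1), pairSpan α m i = ⊤ := by
  have h : ∀ k ≤ m + 1,
      (⊤ : Submodule ℂ (Slice α m → ℂ)) ≤ (⨆ i : Fin (m + 1), pairSpan α m i) ⊔
        pairSetSpan α m k := by
    intro k
    induction k with
    | zero => intro _; rw [pairSetSpan_zero]; exact le_sup_right
    | succ k ih =>
      intro hk
      refine (ih (by omega)).trans (sup_le le_sup_left ((pairSetSpan_le m k).trans ?_))
      exact sup_le_sup_right
        (le_iSup (fun i : Fin (m + 1) => pairSpan α m i) ⟨k, by omega⟩) _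
  -- The filtration stops here: `m + 1` pairs would leave a set of negative size.
  have h₀ : pairSetSpan α m (m + 1) = ⊥ := by
    refine eq_bot_iff.2 (Submodule.span_le.2 ?_)
    rintro _ ⟨L, C, -, -, hC, -⟩
    omega
  have := h (m + 1) le_rfl
  rw [h₀, sup_bot_eq] at this
  exact eq_top_iff.2 this

/-- A product with all first letters outside `B` and all second letters inside takes the value 1 at
`B`. The complement of `B` is large enough because `m ≤ n`. -/
lemma pairSpan_ne_bot {n m i : ℕ} (hα : Fintype.card α = n + m) (hmn : m ≤ n) (hi : i ≤ m) :
    pairSpan α m i ≠ ⊥ := by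
  obtain ⟨B, -, hB⟩ := Finset.exists_subset_card_eq (s := (Finset.univ : Finset α)) (n := m)
    (by rw [Finset.card_univ, hα]; omega)
  have hB' : i ≤ Bᶜ.card := by rw [Finset.card_compl, hα, hB]; omega
  let a : Fin i → α := fun j => (Bᶜ.equivFin.symm (Fin.castLE hB' j)).1
  let b : Fin i → α := fun j => (B.equivFin.symm (Fin.castLE (hi.trans hB.ge) j)).1
  have ha : ∀ j, a j ∉ B := fun j => Finset.mem_compl.1 (Bᶜ.equivFin.symm _).2
  have hb : ∀ j, b j ∈ B := fun j => (B.equivFin.symm _).2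
  have hL := nodup_letters_ofFn (a := a) (b := b)
    (Subtype.val_injective.comp (Bᶜ.equivFin.symm.injective.comp (Fin.castLE_injective _)))
    (Subtype.val_injective.comp (B.equivFin.symm.injective.comp (Fin.castLE_injective _)))
    (fun j k h => ha j (h ▸ hb k))
  intro hbot
  have hmem : pairFun m _ ∈ pairSpan α m i :=
    Submodule.subset_span ⟨_, hL, by simp, rfl⟩
  rw [hbot, Submodule.mem_bot] at hmem
  have h₁ := congrFun hmem ⟨B, hB⟩
  rw [pairFun, pairProd_eq_one] at h₁
  · exact one_ne_zero h₁
  · intro p hp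
    obtain ⟨j, -, rfl⟩ := List.mem_map.1 hp
    exact ha j
  · intro p hp
    obtain ⟨j, -, rfl⟩ := List.mem_map.1 hp
    exact hb j

lemma johnson_of_mem_pairSpan {n m ℓ i : ℕ} (hα : Fintype.card α = n + m) {f : Slice α m → ℂ}
    (hf : f ∈ pairSpan α m i) :
    johnson α m ℓ f = (johnsonEigenvalue i (m - i) (n - i) ℓ : ℂ) • f := by
  induction hf using Submodule.span_induction with
  | mem x hx =>
    obtain ⟨L, hL, rfl, rfl⟩ := hx
    exact johnson_pairFun hα hL
  | zero => simp
  | add x y _ _ hx hy => rw [map_add, hx, hy, smul_add]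
  | smul c x _ hx => rw [map_smul, hx, smul_comm]

end Johnson

/-! ### Column tabloids as functions on `m`-element sets -/

section Tabloids

variable {n m : ℕ} {hmn : m ≤ n} {N : ℕ}

lemma cellEquiv_inl_col (i : Fin n) : (cellEquiv n m hmn (Sum.inl i)).col = 0 := rfl

lemma cellEquiv_inr_col (j : Fin m) : (cellEquiv n m hmn (Sum.inr j)).col = 1 := rfl

lemma col_eq_iff (c d : Cell (twoColumn n m hmn)) : c.col = d.col ↔ (c.col = 1 ↔ d.col = 1) := by
  have h₁ := mem_twoColumn.1 c.2
  have h₂ := mem_twoColumn.1 d.2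
  simp only [Cell.col]
  omega

/-- The entries of the first column, by row. -/
def leftEntry (t : Tableau (twoColumn n m hmn) N) : Fin n ↪ Fin N :=
  (Function.Embedding.inl.trans (cellEquiv n m hmn).toEmbedding).trans t.toEmbedding

/-- The entries of the second column, by row. -/
def rightEntry (t : Tableau (twoColumn n m hmn) N) : Fin m ↪ Fin N :=
  (Function.Embedding.inr.trans (cellEquiv n m hmn).toEmbedding).trans t.toEmbedding

lemma leftEntry_apply (t : Tableau (twoColumn n m hmn) N) (i : Fin n) :
    leftEntry t i = t (cellEquiv n m hmn (Sum.inl i)) := rfl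

lemma rightEntry_apply (t : Tableau (twoColumn n m hmn) N) (j : Fin m) :
    rightEntry t j = t (cellEquiv n m hmn (Sum.inr j)) := rfl

lemma leftEntry_ne_rightEntry (t : Tableau (twoColumn n m hmn) N) (i : Fin n) (j : Fin m) :
    leftEntry t i ≠ rightEntry t j := by
  simp [leftEntry_apply, rightEntry_apply]

/-- The set of entries of the second column. -/
def secondColumn (t : Tableau (twoColumn n m hmn) N) : Slice (Fin N) m :=
  ⟨Finset.univ.map (rightEntry t), by simp⟩

lemma mem_secondColumn (t : Tableau (twoColumn n m hmn) N) (x : Fin N) :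
    x ∈ (secondColumn t).1 ↔ (t.symm x).col = 1 := by
  simp only [secondColumn, Finset.mem_map, Finset.mem_univ, true_and, rightEntry_apply]
  constructor
  · rintro ⟨j, rfl⟩
    rw [symm_apply_apply]
    rfl
  · intro h
    obtain ⟨y, hy⟩ := (cellEquiv n m hmn).surjective (t.symm x)
    rcases y with i | j
    · rw [← hy, cellEquiv_inl_col] at h
      omega
    · exact ⟨j, by rw [hy, apply_symm_apply]⟩

lemma compl_secondColumn (t : Tableau (twoColumn n m hmn) N) :
    (secondColumn t).1ᶜ = Finset.univ.map (leftEntry t) := by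
  ext x
  obtain ⟨c, rfl⟩ := t.surjective x
  obtain ⟨y, rfl⟩ := (cellEquiv n m hmn).surjective c
  rw [Finset.mem_compl, mem_secondColumn, symm_apply_apply]
  rcases y with i | j
  · simp [leftEntry_apply, cellEquiv_inl_col]
  · simp [leftEntry_apply, cellEquiv_inr_col]

lemma secondColumn_trans (t : Tableau (twoColumn n m hmn) N) (σ : Perm (Fin N)) :
    secondColumn (t.trans σ) = slicePerm σ (secondColumn t) := by
  ext x
  rw [mem_secondColumn, coe_slicePerm, mem_map_perm, mem_secondColumn]
  rfl

lemma secondColumn_perm {ρ : Perm (Cell (twoColumn n m hmn))} (hρ : ∀ c, (ρ c).col = c.col)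
    (t : Tableau (twoColumn n m hmn) N) : secondColumn (ρ.trans t) = secondColumn t := by
  ext x
  rw [mem_secondColumn, mem_secondColumn, symm_trans_apply, ← hρ, apply_symm_apply]

/-- The sign of the permutation taking one tableau to another. -/
def relSign {μ : YoungDiagram} (t₀ t : Tableau μ N) : ℂ :=
  ((Perm.sign (t₀.symm.trans t : Perm (Fin N)) : ℤ) : ℂ)

lemma signC_mul_self {β : Type*} [Fintype β] [DecidableEq β] (σ : Perm β) :
    ((Perm.sign σ : ℤ) : ℂ) * ((Perm.sign σ : ℤ) : ℂ) = 1 := by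
  rw [← Int.cast_mul, ← Units.val_mul, Int.units_mul_self]
  simp

lemma relSign_mul_self {μ : YoungDiagram} (t₀ t : Tableau μ N) :
    relSign t₀ t * relSign t₀ t = 1 := signC_mul_self _

lemma relSign_trans {μ : YoungDiagram} (t₀ t : Tableau μ N) (σ : Perm (Fin N)) :
    relSign t₀ (t.trans σ) = ((Perm.sign σ : ℤ) : ℂ) * relSign t₀ t := by
  have : (t₀.symm.trans (t.trans σ) : Perm (Fin N)) = σ * (t₀.symm.trans t : Perm (Fin N)) := rfl
  rw [relSign, this, Perm.sign_mul, Units.val_mul, Int.cast_mul]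
  rfl

lemma relSign_perm {μ : YoungDiagram} (t₀ t : Tableau μ N) (ρ : Perm (Cell μ)) :
    relSign t₀ (ρ.trans t) = ((Perm.sign ρ : ℤ) : ℂ) * relSign t₀ t := by
  have : (t₀.symm.trans (ρ.trans t) : Perm (Fin N)) =
      (t₀.symm.trans t : Perm (Fin N)) * t₀.permCongr ρ := by
    ext x
    simp [permCongr_apply]
  rw [relSign, this, Perm.sign_mul, Perm.sign_permCongr, Units.val_mul, Int.cast_mul, mul_comm]
  rfl

/-- Tableaux with the same second column differ by a column-preserving permutation of cells, whose
sign appears both in the tabloid and in `relSign` and cancels. -/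
lemma relSign_smul_tabloid_eq (t₀ : Tableau (twoColumn n m hmn) N)
    {s s' : Tableau (twoColumn n m hmn) N} (h : secondColumn s = secondColumn s') :
    relSign t₀ s • tabloid s = relSign t₀ s' • tabloid s' := by
  let ρ : Perm (Cell (twoColumn n m hmn)) := s.trans s'.symm
  have hs : s = ρ.trans s' := by ext x; simp [ρ]
  have hρ : ∀ c, (ρ c).col = c.col := by
    intro c
    rw [col_eq_iff]
    have h₁ := mem_secondColumn s (s c)
    have h₂ := mem_secondColumn s' (s c)
    rw [symm_apply_apply] at h₁
    rw [← h₁, h, h₂]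
    rfl
  rw [hs, tabloid_perm ρ hρ, relSign_perm, smul_smul, mul_right_comm, signC_mul_self, one_mul]

/-- Tabloids as signed indicator functions of the second column, on tableaux. -/
def sliceFree (t₀ : Tableau (twoColumn n m hmn) N) :
    (Tableau (twoColumn n m hmn) N →₀ ℂ) →ₗ[ℂ] (Slice (Fin N) m → ℂ) :=
  Finsupp.linearCombination ℂ fun t => relSign t₀ t • Pi.single (secondColumn t) (1 : ℂ)

lemma columnRelations_le_ker_sliceFree (t₀ : Tableau (twoColumn n m hmn) N) :
    columnRelations (twoColumn n m hmn) N ≤ LinearMap.ker (sliceFree t₀) := by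
  refine Submodule.span_le.2 ?_
  rintro _ ⟨t, a, b, hab, hc, rfl⟩
  have h : secondColumn ((swap a b).trans t) = secondColumn t := by
    refine secondColumn_perm (fun c => ?_) t
    rw [swap_apply_def]
    split_ifs with h₁ h₂
    · rw [h₁, hc]
    · rw [h₂, hc]
    · rfl
  simp [sliceFree, h, relSign_perm, Perm.sign_swap hab]

/-- Tabloids as signed indicator functions of the second column. -/
def toSlice (t₀ : Tableau (twoColumn n m hmn) N) :
    TabloidSpace (twoColumn n m hmn) N →ₗ[ℂ] (Slice (Fin N) m → ℂ) :=
  (columnRelations (twoColumn n m hmn) N).liftQ (sliceFree t₀)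
    (columnRelations_le_ker_sliceFree t₀)

lemma toSlice_tabloid (t₀ t : Tableau (twoColumn n m hmn) N) :
    toSlice t₀ (tabloid t) = relSign t₀ t • Pi.single (secondColumn t) (1 : ℂ) := by
  simp [toSlice, tabloid, sliceFree]

lemma exists_secondColumn_eq (t₀ : Tableau (twoColumn n m hmn) N) (B : Slice (Fin N) m) :
    ∃ t : Tableau (twoColumn n m hmn) N, secondColumn t = B := by
  obtain ⟨σ, hσ⟩ := Equiv.Perm.exists_map_finset_eq (secondColumn t₀).1 B.1
    (by rw [(secondColumn t₀).2, B.2])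
  exact ⟨t₀.trans σ, by rw [secondColumn_trans]; exact Subtype.ext hσ⟩

/-- Column tabloids of shape `2^m 1^{n-m}` are the functions on `m`-element sets of letters. -/
def sliceEquiv (t₀ : Tableau (twoColumn n m hmn) N) :
    TabloidSpace (twoColumn n m hmn) N ≃ₗ[ℂ] (Slice (Fin N) m → ℂ) :=
  LinearEquiv.ofLinearMap (toSlice t₀)
    -- The inverse uses an arbitrary tableau with second column `B`; by `relSign_smul_tabloid_eq`
    -- the choice is immaterial.
    ((Pi.basisFun ℂ (Slice (Fin N) m)).constr ℂ fun B =>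
      relSign t₀ (exists_secondColumn_eq t₀ B).choose •
        tabloid (exists_secondColumn_eq t₀ B).choose)
    (by
      refine (Pi.basisFun ℂ (Slice (Fin N) m)).ext fun B => ?_
      rw [LinearMap.comp_apply, Module.Basis.constr_basis, map_smul, toSlice_tabloid, smul_smul,
        relSign_mul_self, one_smul, (exists_secondColumn_eq t₀ B).choose_spec]
      simp)
    (by
      refine tabloidSpace_hom_ext fun t => ?_
      rw [LinearMap.comp_apply, toSlice_tabloid, map_smul, ← Pi.basisFun_apply,
        Module.Basis.constr_basis,
        relSign_smul_tabloid_eq t₀ (exists_secondColumn_eq t₀ (secondColumn t)).choose_spec,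
        smul_smul, relSign_mul_self, one_smul]
      rfl)

lemma sliceEquiv_tabloid (t₀ t : Tableau (twoColumn n m hmn) N) :
    sliceEquiv t₀ (tabloid t) = relSign t₀ t • Pi.single (secondColumn t) (1 : ℂ) :=
  toSlice_tabloid t₀ t

lemma sliceEquiv_tabloidRep (t₀ : Tableau (twoColumn n m hmn) N) (σ : Perm (Fin N))
    (x : TabloidSpace (twoColumn n m hmn) N) :
    sliceEquiv t₀ (tabloidRep (twoColumn n m hmn) N σ x) =
      ((Perm.sign σ : ℤ) : ℂ) • (sliceEquiv t₀ x ∘ (slicePerm σ).symm) := by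
  have : (sliceEquiv t₀).toLinearMap ∘ₗ tabloidRep (twoColumn n m hmn) N σ =
      ((Perm.sign σ : ℤ) : ℂ) • (LinearMap.funLeft ℂ ℂ (slicePerm σ).symm ∘ₗ
        (sliceEquiv t₀).toLinearMap) := by
    refine tabloidSpace_hom_ext fun t => ?_
    ext B
    simp only [LinearMap.comp_apply, tabloidRep_tabloid, LinearEquiv.coe_coe, sliceEquiv_tabloid,
      LinearMap.smul_apply, relSign_trans, secondColumn_trans, Pi.smul_apply,
      LinearMap.funLeft_apply, Pi.single_apply, symm_apply_eq, smul_eq_mul, mul_assoc]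
  exact LinearMap.congr_fun this x

/-! ### The exchange operator is a distance operator -/

/-- The exchange is an involution fixing all but $2\ell$ of the positions, hence a product of $\ell$
transpositions. -/
lemma sign_exchange {ℓ : ℕ} (A : {A : Finset (Fin n) // A.card = ℓ})
    (B : {B : Finset (Fin m) // B.card = ℓ}) : Perm.sign (exchange hmn A B) = (-1) ^ ℓ := by
  rw [exchange, Perm.sign_permCongr]
  have h₁ : exchangePerm A B ^ 2 = 1 := by
    ext1 x
    rw [sq]
    exact exchangeFun_involutive A B x
  rw [Perm.sign_of_pow_two_eq_one h₁]
  congr 1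
  have h₂ : Fintype.card (Function.fixedPoints (exchangePerm A B)) = (n - ℓ) + (m - ℓ) := by
    have : ∀ x, x ∈ Function.fixedPoints (exchangePerm A B) ↔ x ∈ A.1ᶜ.disjSum B.1ᶜ := by
      rintro (i | j)
      · change exchangeFun A B (Sum.inl i) = _ ↔ _
        by_cases h : i ∈ A.1 <;> simp [exchangeFun, h]
      · change exchangeFun A B (Sum.inr j) = _ ↔ _
        by_cases h : j ∈ B.1 <;> simp [exchangeFun, h]
    rw [Fintype.card_of_subtype _ fun x => (this x).symm, Finset.card_disjSum, Finset.card_compl,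
      Finset.card_compl, A.2, B.2, Fintype.card_fin, Fintype.card_fin]
  have hA := Finset.card_le_univ A.1
  have hB := Finset.card_le_univ B.1
  rw [A.2, Fintype.card_fin] at hA
  rw [B.2, Fintype.card_fin] at hB
  rw [h₂, Fintype.card_sum, Fintype.card_fin, Fintype.card_fin]
  omega

lemma secondColumn_exchange {ℓ : ℕ} (A : {A : Finset (Fin n) // A.card = ℓ})
    (B : {B : Finset (Fin m) // B.card = ℓ}) (t : Tableau (twoColumn n m hmn) N) :
    (secondColumn ((exchange hmn A B).trans t)).1 =
      ((secondColumn t).1 \ B.1.map (rightEntry t)) ∪ A.1.map (leftEntry t) := by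
  ext x
  obtain ⟨c, rfl⟩ := t.surjective x
  obtain ⟨y, rfl⟩ := (cellEquiv n m hmn).surjective c
  have hs : ((exchange hmn A B).trans t).symm (t (cellEquiv n m hmn y)) =
      cellEquiv n m hmn (exchangeFun A B y) := by
    rw [symm_apply_eq]
    simp only [exchange, trans_apply, permCongr_apply, symm_apply_apply]
    change _ = t (cellEquiv n m hmn (exchangeFun A B (exchangeFun A B y)))
    rw [exchangeFun_involutive]
  rw [mem_secondColumn, hs, Finset.mem_union, Finset.mem_sdiff, mem_secondColumn,
    symm_apply_apply]
  rcases y with i | j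
  · by_cases h : i ∈ A.1 <;>
      simp [exchangeFun, h, leftEntry_apply, cellEquiv_inl_col, cellEquiv_inr_col]
  · by_cases h : j ∈ B.1 <;>
      simp [exchangeFun, h, leftEntry_apply, rightEntry_apply, cellEquiv_inl_col,
        cellEquiv_inr_col]

lemma sum_subsets_map {k ℓ : ℕ} (e : Fin k ↪ Fin N) (F : Finset (Fin N) → ℂ) :
    ∑ A : {A : Finset (Fin k) // A.card = ℓ}, F (A.1.map e) =
      ∑ A ∈ (Finset.univ.map e).powersetCard ℓ, F A := by
  rw [Finset.powersetCard_map, Finset.sum_map]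
  exact (Finset.sum_subtype (p := fun A : Finset (Fin k) => A.card = ℓ)
    (Finset.univ.powersetCard ℓ) (by simp [Finset.mem_powersetCard])
    fun A => F (A.map e)).symm

lemma johnson_single {ℓ : ℕ} (S B : Slice (Fin N) m) :
    johnson (Fin N) m ℓ (Pi.single S 1) B =
      ∑ A ∈ S.1ᶜ.powersetCard ℓ, ∑ C ∈ S.1.powersetCard ℓ,
        if (S.1 \ C) ∪ A = B.1 then (1 : ℂ) else 0 := by
  rw [← sum_slice_eq_sum_exchange (fun D => if D = B.1 then (1 : ℂ) else 0) S, johnson_apply,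
    Finset.sum_eq_single S, Finset.sum_eq_single B]
  · have : (B.1 \ S.1).card = (S.1 \ B.1).card := Finset.card_sdiff_comm (by rw [B.2, S.2])
    simp [this]
  · intro B' _ hne
    have : B'.1 ≠ B.1 := fun h => hne (Subtype.ext h)
    simp [this]
  · simp
  · intro B' _ hne
    simp [hne]
  · simp

/-- The exchanges reach every set at distance `ℓ` from the second column exactly once, and each
multiplies `relSign` by $(-1)^\ell$. -/
lemma sliceEquiv_eta (t₀ : Tableau (twoColumn n m hmn) N) (ℓ : ℕ)
    (x : TabloidSpace (twoColumn n m hmn) N) :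
    sliceEquiv t₀ (eta hmn ℓ N x) =
      (m.choose ℓ : ℂ) • sliceEquiv t₀ x - (-1 : ℂ) ^ ℓ • johnson (Fin N) m ℓ (sliceEquiv t₀ x) := by
  have : (sliceEquiv t₀).toLinearMap ∘ₗ eta hmn ℓ N =
      (m.choose ℓ : ℂ) • (sliceEquiv t₀).toLinearMap -
        (-1 : ℂ) ^ ℓ • (johnson (Fin N) m ℓ ∘ₗ (sliceEquiv t₀).toLinearMap) := by
    refine tabloidSpace_hom_ext fun t => ?_
    simp only [LinearMap.comp_apply, LinearMap.sub_apply, LinearMap.smul_apply, eta_tabloid,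
      LinearEquiv.coe_coe, map_sub, map_smul, map_sum]
    congr 1
    ext B
    simp only [Finset.sum_apply, sliceEquiv_tabloid, relSign_perm, sign_exchange, map_smul,
      Pi.smul_apply, smul_eq_mul, johnson_single]
    have h : ∀ (A : {A : Finset (Fin n) // A.card = ℓ}) (C : {C : Finset (Fin m) // C.card = ℓ}),
        (Pi.single (secondColumn ((exchange hmn A C).trans t)) 1 : Slice (Fin N) m → ℂ) B =
          if ((secondColumn t).1 \ C.1.map (rightEntry t)) ∪ A.1.map (leftEntry t) = B.1
            then 1 else 0 := by
      intro A C
      rw [Pi.single_apply, ← secondColumn_exchange]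
      refine if_congr ?_ rfl rfl
      rw [Subtype.ext_iff, eq_comm]
    simp only [h, ← Finset.mul_sum]
    rw [compl_secondColumn, ← sum_subsets_map (leftEntry t) fun A =>
      ∑ C ∈ (secondColumn t).1.powersetCard ℓ,
        if ((secondColumn t).1 \ C) ∪ A = B.1 then (1 : ℂ) else 0]
    have h' : ∀ A : Finset (Fin N), ∑ C ∈ (secondColumn t).1.powersetCard ℓ,
        (if ((secondColumn t).1 \ C) ∪ A = B.1 then (1 : ℂ) else 0) =
          ∑ C : {C : Finset (Fin m) // C.card = ℓ},
            if ((secondColumn t).1 \ C.1.map (rightEntry t)) ∪ A = B.1 then (1 : ℂ) else 0 :=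
      fun A => (sum_subsets_map (rightEntry t) fun C =>
        if ((secondColumn t).1 \ C) ∪ A = B.1 then (1 : ℂ) else 0).symm
    simp only [h']
    push_cast
    ring
  exact LinearMap.congr_fun this x

end Tabloids

/-! ### The Specht module inside the space of column tabloids -/

section GroupAlgebra

variable {μ : YoungDiagram} {N : ℕ}

/-- The sum of the row stabilizer. -/
def rowSum (t : Tableau μ N) : MonoidAlgebra ℂ (Perm (Fin N)) :=
  ∑ α ∈ rowStabilizer t, MonoidAlgebra.of ℂ (Perm (Fin N)) α

/-- The signed sum of the column stabilizer. -/
def colSum (t : Tableau μ N) : MonoidAlgebra ℂ (Perm (Fin N)) :=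
  ∑ β ∈ colStabilizer t, ((Perm.sign β : ℤ) : ℂ) • MonoidAlgebra.of ℂ (Perm (Fin N)) β

lemma youngSymmetrizer_eq (t : Tableau μ N) : youngSymmetrizer t = rowSum t * colSum t := rfl

lemma mem_rowStabilizer {t : Tableau μ N} {σ : Perm (Fin N)} :
    σ ∈ rowStabilizer t ↔ ∀ x, (t.symm (σ x)).row = (t.symm x).row := by
  simp [rowStabilizer]

lemma mem_colStabilizer {t : Tableau μ N} {σ : Perm (Fin N)} :
    σ ∈ colStabilizer t ↔ ∀ x, (t.symm (σ x)).col = (t.symm x).col := by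
  simp [colStabilizer]

lemma of_mul_rowSum {t : Tableau μ N} {σ : Perm (Fin N)} (hσ : σ ∈ rowStabilizer t) :
    MonoidAlgebra.of ℂ (Perm (Fin N)) σ * rowSum t = rowSum t := by
  rw [mem_rowStabilizer] at hσ
  rw [rowSum, Finset.mul_sum]
  refine Finset.sum_nbij' (σ * ·) (σ⁻¹ * ·) ?_ ?_ (fun γ _ => inv_mul_cancel_left σ γ)
    (fun γ _ => mul_inv_cancel_left σ γ) fun γ _ => (map_mul _ _ _).symm
  · intro γ hγ
    rw [mem_rowStabilizer] at hγ ⊢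
    intro x
    rw [Perm.mul_apply, hσ, hγ]
  · intro γ hγ
    rw [mem_rowStabilizer] at hγ ⊢
    intro x
    rw [Perm.mul_apply, ← hσ, ← Perm.mul_apply σ, mul_inv_cancel, Perm.one_apply, hγ]

lemma of_mul_colSum {t : Tableau μ N} {σ : Perm (Fin N)} (hσ : σ ∈ colStabilizer t) :
    MonoidAlgebra.of ℂ (Perm (Fin N)) σ * colSum t = ((Perm.sign σ : ℤ) : ℂ) • colSum t := by
  rw [mem_colStabilizer] at hσ
  rw [colSum, Finset.mul_sum, Finset.smul_sum]
  refine Finset.sum_nbij' (σ * ·) (σ⁻¹ * ·) ?_ ?_ (fun γ _ => inv_mul_cancel_left σ γ)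
    (fun γ _ => mul_inv_cancel_left σ γ) fun γ _ => ?_
  · intro γ hγ
    rw [mem_colStabilizer] at hγ ⊢
    intro x
    rw [Perm.mul_apply, hσ, hγ]
  · intro γ hγ
    rw [mem_colStabilizer] at hγ ⊢
    intro x
    rw [Perm.mul_apply, ← hσ, ← Perm.mul_apply σ, mul_inv_cancel, Perm.one_apply, hγ]
  · rw [mul_smul_comm, ← map_mul, smul_smul, Perm.sign_mul, Units.val_mul, Int.cast_mul,
      ← mul_assoc, signC_mul_self, one_mul]

lemma colSum_mul_self (t : Tableau μ N) :
    colSum t * colSum t = ((colStabilizer t).card : ℂ) • colSum t := by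
  nth_rw 1 [colSum]
  rw [Finset.sum_mul, Finset.sum_congr rfl (g := fun _ => colSum t), Finset.sum_const,
    Nat.cast_smul_eq_nsmul]
  intro β hβ
  rw [smul_mul_assoc, of_mul_colSum hβ, smul_smul, signC_mul_self, one_smul]

lemma card_colStabilizer_ne_zero (t : Tableau μ N) : ((colStabilizer t).card : ℂ) ≠ 0 := by
  rw [Nat.cast_ne_zero]
  exact Finset.card_ne_zero_of_mem (a := 1) (mem_colStabilizer.2 fun x => rfl)

/-- Column tabloids embed into the group algebra by `[s] ↦ σ C_t`, where `s = σ t`. -/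
def toGroupAlgebra (t : Tableau μ N) : TabloidSpace μ N →ₗ[ℂ] MonoidAlgebra ℂ (Perm (Fin N)) :=
  (columnRelations μ N).liftQ
    (Finsupp.linearCombination ℂ fun s : Tableau μ N =>
      MonoidAlgebra.of ℂ (Perm (Fin N)) (t.symm.trans s) * colSum t)
    (by
      refine Submodule.span_le.2 ?_
      rintro _ ⟨s, a, b, hab, hc, rfl⟩
      -- Switching cells is right multiplication by a swap in the column stabilizer of `t`, which
      -- `colSum t` absorbs with sign -1.
      have h₁ : (t.symm.trans ((swap a b).trans s) : Perm (Fin N)) =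
          (t.symm.trans s : Perm (Fin N)) * swap (t a) (t b) := by
        rw [← symm_trans_swap_trans a b t]
        ext1 x
        simp only [Perm.mul_apply, trans_apply, symm_apply_apply]
      have h₂ : swap (t a) (t b) ∈ colStabilizer t := by
        rw [mem_colStabilizer]
        intro x
        rw [swap_apply_def]
        split_ifs with h h
        · rw [h, symm_apply_apply, symm_apply_apply, hc]
        · rw [h, symm_apply_apply, symm_apply_apply, hc]
        · rfl
      have h₃ : Perm.sign (swap (t a) (t b)) = -1 := Perm.sign_swap (t.injective.ne hab)
      rw [SetLike.mem_coe, LinearMap.mem_ker, map_add, Finsupp.linearCombination_single,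
        Finsupp.linearCombination_single, h₁, map_mul, mul_assoc, of_mul_colSum h₂, h₃]
      simp)

lemma toGroupAlgebra_tabloid (t s : Tableau μ N) : toGroupAlgebra t (tabloid s) =
    MonoidAlgebra.of ℂ (Perm (Fin N)) (t.symm.trans s) * colSum t := by
  simp [toGroupAlgebra, tabloid]

/-- The map `x ↦ x [t]` from the group algebra to the column tabloids. -/
def orbitMap (t : Tableau μ N) : MonoidAlgebra ℂ (Perm (Fin N)) →ₗ[ℂ] TabloidSpace μ N :=
  LinearMap.applyₗ (tabloid t) ∘ₗ (tabloidRep μ N).asAlgebraHom.toLinearMap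

lemma orbitMap_mul (t : Tableau μ N) (x y : MonoidAlgebra ℂ (Perm (Fin N))) :
    orbitMap t (x * y) = (tabloidRep μ N).asAlgebraHom x (orbitMap t y) := by
  simp [orbitMap]

lemma orbitMap_of (t : Tableau μ N) (σ : Perm (Fin N)) :
    orbitMap t (MonoidAlgebra.of ℂ (Perm (Fin N)) σ) = tabloid (t.trans σ) := by
  rw [← tabloidRep_tabloid, ← Representation.asAlgebraHom_of]
  rfl

lemma orbitMap_of_mul (t : Tableau μ N) (σ : Perm (Fin N))
    (x : MonoidAlgebra ℂ (Perm (Fin N))) :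
    orbitMap t (MonoidAlgebra.of ℂ (Perm (Fin N)) σ * x) = tabloidRep μ N σ (orbitMap t x) := by
  rw [orbitMap_mul, Representation.asAlgebraHom_of]

lemma toGroupAlgebra_orbitMap (t : Tableau μ N) (x : MonoidAlgebra ℂ (Perm (Fin N))) :
    toGroupAlgebra t (orbitMap t x) = x * colSum t := by
  induction x using MonoidAlgebra.induction_on with
  | of σ =>
    rw [orbitMap_of, toGroupAlgebra_tabloid]
    congr 2
    ext y
    simp
  | add x y hx hy => rw [map_add, map_add, hx, hy, add_mul]
  | smul c x hx => rw [map_smul, map_smul, hx, smul_mul_assoc]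

lemma mul_colSum_of_mem_spechtSubmodule {t : Tableau μ N} {x : MonoidAlgebra ℂ (Perm (Fin N))}
    (hx : x ∈ spechtSubmodule t) : x * colSum t = ((colStabilizer t).card : ℂ) • x := by
  induction hx using Submodule.span_induction with
  | mem x hx =>
    obtain ⟨τ, rfl⟩ := hx
    simp only [youngSymmetrizer_eq, mul_assoc, colSum_mul_self, mul_smul_comm]
  | zero => simp
  | add x y _ _ hx hy => rw [add_mul, hx, hy, smul_add]
  | smul c x _ hx => rw [smul_mul_assoc, hx, smul_comm]

/-- Following the map by `toGroupAlgebra t` gives right multiplication by `colSum t`, which on the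
Specht module is the nonzero scalar $|C_t|$. -/
lemma orbitMap_injOn (t : Tableau μ N) :
    Function.Injective (orbitMap t ∘ₗ (spechtSubmodule t).subtype) := by
  refine (injective_iff_map_eq_zero _).2 fun x hx => ?_
  have h := congrArg (toGroupAlgebra t) hx
  rw [LinearMap.comp_apply, toGroupAlgebra_orbitMap, map_zero, Submodule.subtype_apply,
    mul_colSum_of_mem_spechtSubmodule x.2] at h
  exact Subtype.ext ((smul_eq_zero.1 h).resolve_left (card_colStabilizer_ne_zero t))

lemma orbitMap_colSum (t : Tableau μ N) :
    orbitMap t (colSum t) = ((colStabilizer t).card : ℂ) • tabloid t := by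
  rw [colSum, map_sum, Finset.sum_congr rfl (g := fun _ => tabloid t), Finset.sum_const,
    Nat.cast_smul_eq_nsmul]
  intro β hβ
  rw [mem_colStabilizer] at hβ
  have : t.trans β = (t.symm.permCongr β).trans t := by
    ext x
    simp [permCongr_apply]
  rw [map_smul, orbitMap_of, this, tabloid_perm, Perm.sign_permCongr, smul_smul, signC_mul_self,
    one_smul]
  intro c
  rw [permCongr_apply, symm_symm, hβ, symm_apply_apply]

lemma orbitMap_youngSymmetrizer (t : Tableau μ N) (τ : Perm (Fin N)) :
    orbitMap t (MonoidAlgebra.of ℂ (Perm (Fin N)) τ * youngSymmetrizer t) =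
      ((colStabilizer t).card : ℂ) • tabloidRep μ N τ (orbitMap t (rowSum t)) := by
  rw [orbitMap_of_mul, youngSymmetrizer_eq, orbitMap_mul, orbitMap_colSum, map_smul, map_smul]
  rfl

end GroupAlgebra

/-! ### The image of the Specht module for two columns -/

section TwoColumns

variable {n m : ℕ} {hmn : m ≤ n} {N : ℕ}

/-- The pairs of entries in the rows with two cells. -/
def rowPairs (t : Tableau (twoColumn n m hmn) N) : List (Fin N × Fin N) :=
  (List.finRange m).map fun j => (leftEntry t (Fin.castLE hmn j), rightEntry t j)

lemma nodup_letters_rowPairs (t : Tableau (twoColumn n m hmn) N) :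
    (letters (rowPairs t)).Nodup :=
  nodup_letters_ofFn ((leftEntry t).injective.comp (Fin.castLE_injective hmn))
    (rightEntry t).injective fun _ _ => leftEntry_ne_rightEntry t _ _

lemma length_rowPairs (t : Tableau (twoColumn n m hmn) N) : (rowPairs t).length = m := by
  simp [rowPairs]

lemma swap_mem_rowStabilizer {t : Tableau (twoColumn n m hmn) N} {p : Fin N × Fin N}
    (hp : p ∈ rowPairs t) : swap p.1 p.2 ∈ rowStabilizer t := by
  obtain ⟨j, -, rfl⟩ := List.mem_map.1 hp
  rw [mem_rowStabilizer]
  intro x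
  have h : (t.symm (leftEntry t (Fin.castLE hmn j))).row = (t.symm (rightEntry t j)).row := by
    rw [leftEntry_apply, rightEntry_apply, symm_apply_apply, symm_apply_apply]
    rfl
  rw [swap_apply_def]
  split_ifs with h₁ h₂
  · rw [h₁, h]
  · rw [h₂, h]
  · rfl

lemma eq_one_of_mem_rowStabilizer {t : Tableau (twoColumn n m hmn) N} {σ : Perm (Fin N)}
    (hσ : σ ∈ rowStabilizer t) (h : slicePerm σ (secondColumn t) = secondColumn t) : σ = 1 := by
  rw [mem_rowStabilizer] at hσ
  ext1 x
  refine t.symm.injective (Subtype.ext (Prod.ext (hσ x) ?_))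
  refine (col_eq_iff _ _).2 ?_
  rw [Perm.one_apply, ← mem_secondColumn, ← mem_secondColumn]
  nth_rw 1 [← h]
  rw [coe_slicePerm, mem_map_perm, symm_apply_apply]

/-- Row swaps fix `rowSum t`, so the sign twist makes the function antisymmetric under the swap of
each row pair, and `eq_smul_pairFun` determines it up to a scalar. The scalar is the value at the
second column of `t`, to which only the identity of the row stabilizer contributes. -/
lemma sliceEquiv_rowSum (t : Tableau (twoColumn n m hmn) N) :
    sliceEquiv t (orbitMap t (rowSum t)) = pairFun m (rowPairs t) := by
  set g := sliceEquiv t (orbitMap t (rowSum t)) with hg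
  have h₁ : ∀ p ∈ rowPairs t, ∀ B, g (slicePerm (swap p.1 p.2) B) = -g B := by
    intro p hp B
    have hne : p.1 ≠ p.2 := (nodup_letters_iff.1 (nodup_letters_rowPairs t)).2.2 p hp p hp
    have h := sliceEquiv_tabloidRep t (swap p.1 p.2) (orbitMap t (rowSum t))
    rw [← orbitMap_of_mul, of_mul_rowSum (swap_mem_rowStabilizer hp), ← hg,
      Perm.sign_swap hne] at h
    nth_rw 1 [h]
    simp
  have h₂ : g (secondColumn t) = 1 := by
    rw [hg, rowSum, map_sum, map_sum, Finset.sum_apply, Finset.sum_eq_single 1]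
    · rw [orbitMap_of, sliceEquiv_tabloid, secondColumn_trans, relSign_trans]
      have e : slicePerm 1 (secondColumn t) = secondColumn t :=
        (secondColumn_trans t 1).symm
      have e' : relSign t t = 1 := by simp [relSign]
      simp [e, e']
    · intro α hα hne
      rw [orbitMap_of, sliceEquiv_tabloid, secondColumn_trans, Pi.smul_apply,
        Pi.single_eq_of_ne, smul_zero]
      exact fun h => hne (eq_one_of_mem_rowStabilizer hα h.symm)
    · intro h
      exact absurd (mem_rowStabilizer.2 fun x => rfl) h
  have h₃ := eq_smul_pairFun (nodup_letters_rowPairs t) h₁ (B₀ := secondColumn t) (by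
    ext x
    simp [rowPairs, secondColumn])
  rw [h₃, h₂, one_smul]

lemma pairFun_comp_symm (σ : Perm (Fin N)) (L : List (Fin N × Fin N)) :
    pairFun m L ∘ (slicePerm σ).symm = pairFun m (L.map (Prod.map σ σ)) := by
  ext B
  obtain ⟨B', rfl⟩ := (slicePerm σ).surjective B
  simp only [Function.comp_apply, symm_apply_apply, pairFun, coe_slicePerm, pairProd_map]

lemma sliceEquiv_orbitMap (t : Tableau (twoColumn n m hmn) N) (τ : Perm (Fin N)) :
    sliceEquiv t (orbitMap t (MonoidAlgebra.of ℂ (Perm (Fin N)) τ * youngSymmetrizer t)) =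
      (((colStabilizer t).card : ℂ) * ((Perm.sign τ : ℤ) : ℂ)) •
        pairFun m ((rowPairs t).map (Prod.map τ τ)) := by
  rw [orbitMap_youngSymmetrizer, map_smul, sliceEquiv_tabloidRep, sliceEquiv_rowSum,
    pairFun_comp_symm, smul_smul]

/-- The Specht module is spanned by the products of `m` differences. -/
lemma map_spechtSubmodule (t : Tableau (twoColumn n m hmn) N) :
    ((spechtSubmodule t).map (orbitMap t)).map (sliceEquiv t).toLinearMap =
      pairSpan (Fin N) m m := by
  refine le_antisymm ?_ (Submodule.span_le.2 ?_)
  · rw [spechtSubmodule, Submodule.map_span, Submodule.map_span, Submodule.span_le]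
    rintro _ ⟨_, ⟨_, ⟨τ, rfl⟩, rfl⟩, rfl⟩
    simp only [LinearEquiv.coe_coe, sliceEquiv_orbitMap]
    refine Submodule.smul_mem _ _ (Submodule.subset_span ⟨_, ?_, ?_, rfl⟩)
    · rw [letters_map]
      exact (nodup_letters_rowPairs t).map τ.injective
    · rw [List.length_map, length_rowPairs]
  · rintro _ ⟨L, hL, hm, rfl⟩
    -- Any `m` disjoint pairs form a translate of the row pairs, since permutations act transitively
    -- on words of `2 * m` distinct letters.
    obtain ⟨τ, hτ⟩ := exists_perm_map_eq (nodup_letters_rowPairs t) hL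
      (by rw [length_letters, length_letters, length_rowPairs, hm])
    rw [← letters_map] at hτ
    have h := sliceEquiv_orbitMap t τ
    rw [letters_injective hτ] at h
    have h₀ : ((colStabilizer t).card : ℂ) * ((Perm.sign τ : ℤ) : ℂ) ≠ 0 :=
      mul_ne_zero (card_colStabilizer_ne_zero t) fun h => by
        have := signC_mul_self τ
        rw [h, mul_zero] at this
        exact zero_ne_one this
    rw [SetLike.mem_coe, ← Submodule.smul_mem_iff _ h₀, ← h]
    exact Submodule.mem_map_of_mem
      (Submodule.mem_map_of_mem (Submodule.subset_span ⟨τ, rfl⟩))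

end TwoColumns

/-! ### Decomposition of the tabloid space and proof of the equivalence -/

lemma omega_self {n m : ℕ} (ℓ : ℕ) : omega n m ℓ m = 0 := by
  rw [omega, Finset.sum_eq_single 0]
  · simp
  · intro k _ hk
    rw [Nat.sub_self, Nat.choose_eq_zero_of_lt (Nat.pos_of_ne_zero hk)]
    simp
  · simp

lemma omega_one {n m i : ℕ} (hmn : m ≤ n) (hi : i ≤ m) :
    omega n m 1 i = ((m : ℤ) - i) * ((n : ℤ) - i + 1) := by
  simp only [omega, Finset.sum_range_succ, Finset.sum_range_zero, Nat.choose_one_right,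
    Nat.choose_zero_right, Nat.sub_self, Nat.sub_zero, Nat.cast_sub hi,
    Nat.cast_sub (hi.trans hmn)]
  push_cast
  ring

lemma omega_one_ne {n m i j : ℕ} (hmn : m ≤ n) (hi : i < j) (hj : j ≤ m) :
    omega n m 1 i ≠ omega n m 1 j := by
  rw [omega_one hmn (hi.le.trans hj), omega_one hmn hj]
  zify at hmn hi hj
  nlinarith

section Decomposition

variable {n m : ℕ} {hmn : m ≤ n} (t : Tableau (twoColumn n m hmn) (n + m))

/-- The part of the space of tabloids on which `η_ℓ` acts by the scalar `ω_{ℓ,i}`. -/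
def component (i : ℕ) : Submodule ℂ (TabloidSpace (twoColumn n m hmn) (n + m)) :=
  (pairSpan (Fin (n + m)) m i).map (sliceEquiv t).symm.toLinearMap

lemma mem_component {i : ℕ} {x : TabloidSpace (twoColumn n m hmn) (n + m)} :
    x ∈ component t i ↔ sliceEquiv t x ∈ pairSpan (Fin (n + m)) m i := by
  constructor
  · rintro ⟨y, hy, rfl⟩
    simpa using hy
  · intro h
    exact ⟨_, h, by simp⟩

lemma iSup_component : ⨆ i : Fin (m + 1), component t i = ⊤ := by
  simp only [component]
  rw [← Submodule.map_iSup, iSup_pairSpan, Submodule.map_top]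
  exact LinearMap.range_eq_top.2 (sliceEquiv t).symm.surjective

lemma component_ne_bot {i : ℕ} (hi : i ≤ m) : component t i ≠ ⊥ := by
  intro h
  refine pairSpan_ne_bot (α := Fin (n + m)) (Fintype.card_fin _) hmn hi ?_
  exact Submodule.map_eq_bot_iff.1 h

lemma eta_of_mem_component {ℓ i : ℕ} {x : TabloidSpace (twoColumn n m hmn) (n + m)}
    (hx : x ∈ component t i) : eta hmn ℓ (n + m) x = (omega n m ℓ i : ℂ) • x := by
  apply (sliceEquiv t).injective
  rw [sliceEquiv_eta, johnson_of_mem_pairSpan (Fintype.card_fin _) ((mem_component t).1 hx),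
    map_smul, omega_eq, smul_smul, ← sub_smul]
  push_cast
  rfl

lemma component_le_eigenspace (i : ℕ) :
    component t i ≤ Module.End.eigenspace (eta hmn 1 (n + m)) (omega n m 1 i : ℂ) := fun _ hx =>
  Module.End.mem_eigenspace_iff.2 (eta_of_mem_component t hx)

/-- The components do not depend on `ℓ`, so `η_1` can be used to separate them whatever `ℓ` is: its
eigenvalues $(m-i)(n-i+1)$ strictly decrease in $i\le m$, whereas $\omega_{\ell,i}$ may repeat. -/
lemma disjoint_component_last :
    Disjoint (component t m) (⨆ i : Fin m, component t i) := by
  refine (Module.End.eigenspaces_iSupIndep (eta hmn 1 (n + m)) (omega n m 1 m : ℂ)).mono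
    (component_le_eigenspace t m) (iSup_le fun i => (component_le_eigenspace t i).trans ?_)
  exact le_iSup₂_of_le (omega n m 1 i : ℂ)
    (fun h => omega_one_ne hmn i.2 le_rfl (Int.cast_injective h)) le_rfl

lemma component_le_etaSubmodule {ℓ i : ℕ} (h : omega n m ℓ i ≠ 0) :
    component t i ≤ etaSubmodule hmn ℓ (n + m) := by
  intro x hx
  rw [etaSubmodule_eq_range]
  refine ⟨(omega n m ℓ i : ℂ)⁻¹ • x, ?_⟩
  rw [map_smul, eta_of_mem_component t hx, inv_smul_smul₀ (Int.cast_ne_zero.2 h)]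

/-- The operator preserves every component and kills the last one, as $\omega_{\ell,m}=0$. -/
lemma etaSubmodule_le (ℓ : ℕ) :
    etaSubmodule hmn ℓ (n + m) ≤ ⨆ i : Fin m, component t i := by
  rw [etaSubmodule_eq_range, LinearMap.range_eq_map, ← iSup_component t, Submodule.map_iSup]
  refine iSup_le fun i => ?_
  rintro _ ⟨x, hx, rfl⟩
  rw [eta_of_mem_component t hx]
  rcases Nat.lt_succ_iff_lt_or_eq.1 i.2 with h | h
  · exact Submodule.smul_mem _ _
      (Submodule.mem_iSup_of_mem (p := fun i : Fin m => component t i) ⟨i, h⟩ hx)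
  · rw [h, omega_self]
    simp

lemma map_orbitMap_spechtSubmodule :
    (spechtSubmodule t).map (orbitMap t) = component t m := by
  rw [component, ← map_spechtSubmodule t]
  ext x
  simp

lemma component_sup_etaSubmodule {ℓ : ℕ} (h : ∀ i < m, omega n m ℓ i ≠ 0) :
    component t m ⊔ etaSubmodule hmn ℓ (n + m) = ⊤ := by
  refine eq_top_iff.2 ((iSup_component t).ge.trans (iSup_le fun i => ?_))
  rcases Nat.lt_succ_iff_lt_or_eq.1 i.2 with hi | hi
  · exact (component_le_etaSubmodule t (h i hi)).trans le_sup_right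
  · rw [hi]
    exact le_sup_left

/-- The map `x ↦ x [t]` from the Specht module to the quotient by the image of `η_ℓ`. -/
def spechtToQuotient (ℓ : ℕ) : (spechtRep t).IntertwiningMap (quotientRep hmn ℓ (n + m)) where
  toLinearMap := (etaSubmodule hmn ℓ (n + m)).mkQ ∘ₗ orbitMap t ∘ₗ (spechtSubmodule t).subtype
  isIntertwining' σ := by
    ext x
    have h : orbitMap t (Representation.leftRegular ℂ (Perm (Fin (n + m))) σ x.1) =
        tabloidRep _ _ σ (orbitMap t x.1) := by
      rw [leftRegular_apply, orbitMap_of_mul]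
    exact congrArg (etaSubmodule hmn ℓ (n + m)).mkQ h

/-- The Specht module is carried onto the last component, which is a complement of the image of
$\eta_\ell$: they meet trivially for every `ℓ`, and they span because $\eta_\ell$ is invertible on
the other components. -/
lemma spechtToQuotient_bijective {ℓ : ℕ} (h : ∀ i < m, omega n m ℓ i ≠ 0) :
    Function.Bijective (spechtToQuotient t ℓ) := by
  have hmem : ∀ x : spechtSubmodule t, orbitMap t x.1 ∈ component t m := fun x => by
    rw [← map_orbitMap_spechtSubmodule]
    exact Submodule.mem_map_of_mem x.2
  constructor
  · refine (injective_iff_map_eq_zero (spechtToQuotient t ℓ).toLinearMap).2 fun x hx => ?_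
    have hx' : orbitMap t x.1 ∈ etaSubmodule hmn ℓ (n + m) :=
      (Submodule.Quotient.mk_eq_zero _).1 hx
    have h₀ : orbitMap t x.1 = 0 := (Submodule.disjoint_def.1 (disjoint_component_last t)) _
      (hmem x) (etaSubmodule_le t ℓ hx')
    exact (injective_iff_map_eq_zero _).1 (orbitMap_injOn t) x h₀
  · intro y
    obtain ⟨z, rfl⟩ := Submodule.mkQ_surjective _ y
    have hz : z ∈ component t m ⊔ etaSubmodule hmn ℓ (n + m) := by
      rw [component_sup_etaSubmodule t h]
      trivial
    obtain ⟨a, ha, b, hb, rfl⟩ := Submodule.mem_sup.1 hz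
    rw [← map_orbitMap_spechtSubmodule] at ha
    obtain ⟨x, hx, rfl⟩ := ha
    refine ⟨⟨x, hx⟩, ?_⟩
    have hb₀ : (etaSubmodule hmn ℓ (n + m)).mkQ b = 0 := (Submodule.Quotient.mk_eq_zero _).2 hb
    rw [map_add, hb₀, add_zero]
    rfl

lemma finrank_spechtSubmodule :
    Module.finrank ℂ (spechtSubmodule t) = Module.finrank ℂ (component t m) := by
  rw [← map_orbitMap_spechtSubmodule]
  have h : LinearMap.range (orbitMap t ∘ₗ (spechtSubmodule t).subtype) =
      (spechtSubmodule t).map (orbitMap t) := by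
    rw [LinearMap.range_comp, Submodule.range_subtype]
  rw [← h, LinearMap.finrank_range_of_inj (orbitMap_injOn t)]

/-- Dimensions alone suffice. The quotient has the dimension of the kernel of $\eta_\ell$, so the
last component, contained in the kernel, would fill it. A vanishing $\omega_{\ell,i}$ would then put
a nonzero component inside the last one, against disjointness. -/
lemma omega_ne_zero_of_finrank_eq {ℓ : ℕ}
    (h : Module.finrank ℂ (TabloidSpace (twoColumn n m hmn) (n + m) ⧸ etaSubmodule hmn ℓ (n + m)) =
      Module.finrank ℂ (spechtSubmodule t)) {i : ℕ} (hi : i < m) : omega n m ℓ i ≠ 0 := by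
  intro h₀
  have hker : ∀ {j : ℕ}, omega n m ℓ j = 0 →
      component t j ≤ LinearMap.ker (eta hmn ℓ (n + m)) := by
    intro j hj x hx
    rw [LinearMap.mem_ker, eta_of_mem_component t hx, hj, Int.cast_zero, zero_smul]
  have h₁ := (etaSubmodule hmn ℓ (n + m)).finrank_quotient_add_finrank
  have h₂ := (eta hmn ℓ (n + m)).finrank_range_add_finrank_ker
  rw [etaSubmodule_eq_range] at h h₁
  have h₃ : component t m = LinearMap.ker (eta hmn ℓ (n + m)) := by
    refine Submodule.eq_of_le_of_finrank_eq (hker (omega_self ℓ)) ?_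
    rw [← finrank_spechtSubmodule, ← h]
    omega
  refine component_ne_bot t hi.le (disjoint_self.1 ?_)
  refine (disjoint_component_last t).mono ((hker h₀).trans h₃.ge) ?_
  exact le_iSup (fun i : Fin m => component t i) ⟨i, hi⟩

end Decomposition

end TwoColumnSpecht

end

theorem theorem4p1 (n m ℓ : ℕ) (hℓ : 1 ≤ ℓ) (hℓm : ℓ ≤ m) (hmn : m ≤ n)
    (t : TwoColumnSpecht.Tableau (TwoColumnSpecht.twoColumn n m hmn) (n + m)) :
    Nonempty ((TwoColumnSpecht.quotientRep hmn ℓ (n + m)).Equiv (TwoColumnSpecht.spechtRep t)) ↔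
      ∀ i : ℕ, i < m → TwoColumnSpecht.omega n m ℓ i ≠ 0 := by
  constructor
  · rintro ⟨e⟩ i hi
    exact TwoColumnSpecht.omega_ne_zero_of_finrank_eq t e.toLinearEquiv.finrank_eq hi
  · intro h
    exact ⟨((TwoColumnSpecht.spechtToQuotient t ℓ).ofBijective
      (TwoColumnSpecht.spechtToQuotient_bijective t h)).symm⟩
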